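/- Let $S$ be a Steiner tree (for instance a minimum-power one) with non-negative edge costs that consists of one full component, i.e. its leaves are exactly its terminals; let $R$ be the set of terminals, $|R|\ge 2$, and $\rho\in R$ a root terminal. For every node $v$ of degree $d(v)$ let $e_v^1,\dots,e_v^{d(v)}$ be the edges at $v$ in order of non-increasing cost, ties being broken arbitrarily. *Witness tree.* Split an arbitrary edge $ab$ of $S$ and root $S$ at the new node. Every node $v$ with children $w_0,\dots,w_{k-1}$, $k\ge 3$, the edges $vw_j$ being in the above order, is split into a path $v_0=v,v_1,\dots,v_{k-2}$ (by dummy edges), where $v_j$ has the children $w_j$ and $v_{j+1}$ for $j<k-2$, and $v_{k-2}$ has the children $w_{k-2}$ and $w_{k-1}$. Finally shortcut non-root nodes of degree $2$. In the resulting binary tree $S_{bin}$ mark, independently for every internal node, exactly one of its two child edges, uniformly at random. The witness tree $T^*$ has the vertex set $R$, and its edges are the pairs $uw$ such that the path between $u$ and $w$ in $S_{bin}$ contains exactly one marked edge. The witness set $W(f)$ of an edge $f$ of $S$ is the set of the edges $uw$ of $T^*$ such that the path between $u$ and $w$ in $S_{bin}$ contains the edge corresponding to $f$. *Deletion process.*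 Fix $M>0$. In each iteration $t=1,2,\dots$ a vector $(x_{Q,s})_{s\in Q\subseteq R}$ of non-negative reals is given (it may depend on the past) with $\sum_{Q,s}x_{Q,s}=M$ and $\sum_{(Q,s):\,s\notin W,\,Q\cap W\ne\emptyset}x_{Q,s}\ge 1$ for all $\emptyset\ne W\subseteq R\setminus\{\rho\}$. A component with terminal set $Q$ is sampled with probability $\frac1M\sum_{s\in Q}x_{Q,s}$, and a (random) set of non-deleted edges of $T^*$ is deleted so that the non-deleted edges of $T^*$ together with all components sampled so far still connect all terminals. An edge $f$ of $S$ is deleted as soon as all edges of $W(f)$ are deleted. Let $\delta_v^i$ be the expected number of iterations until $e_v^1,\dots,e_v^i$ are all deleted. Then there is a randomized procedure for choosing the edges of $T^*$ to be deleted in each iteration (depending on the non-deleted edges, the components sampled so far, the current vector $x$ and the component just sampled) such that, whatever the vectors $x$ are, for all nodes $v$ and all $1\le i\le d(v)$ $$\delta^i_v\le\delta^i:=\frac{1}{2^i}MH_i+\Big(1-\frac{1}{2^i}\Big)\sum_{q\ge1}\frac{1}{2^q}MH_{q+i},\qquad H_q:=\sum_{j=1}^q\frac1j .$$ Moreover $\delta^2/M=3\ln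 4-\frac94$. -/

import Mathlib

open scoped NNReal ENNReal

noncomputable section

namespace MinPower

open Finset Classical

/-! ## The linear program and the sampling of components -/

/-- A feasible solution `x` of the directed component relaxation for the terminal set `R` with
root `ρ`, the total weight being normalised to `M` by means of the variable of the dummy
component `({ρ}, ρ)`.  There is a variable `x Q s` for every sink `s ∈ Q ⊆ R`; entries with other
indices are `0`.  (The objective of the relaxation changes from iteration to iteration, the
constraints do not.) -/
structure LPSolution {V : Type*} [Fintype V] (R : Finset V) (ρ : V) (M : ℝ) where
  x : Finset V → V → ℝ
  nonneg : ∀ Q s, 0 ≤ x Q s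
  support : ∀ Q s, ¬ (s ∈ Q ∧ Q ⊆ R) → x Q s = 0
  cut : ∀ W : Finset V, W.Nonempty → W ⊆ R.erase ρ →
    1 ≤ ∑ Q with (Q ∩ W).Nonempty, ∑ s ∈ Q with s ∉ W, x Q s
  total : ∑ Q, ∑ s ∈ Q, x Q s = M
  total_pos : 0 < M

/-- The terminal set `Q` of the sampled component: it is `Q` with probability
`(∑ s ∈ Q, x Q s) / M`. -/
def LPSolution.sample {V : Type*} [Fintype V] {R : Finset V} {ρ : V} {M : ℝ}
    (y : LPSolution R ρ M) : PMF (Finset V) :=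
  PMF.ofFintype (fun Q => ENNReal.ofReal ((∑ s ∈ Q, y.x Q s) / M)) (by
    rw [← ENNReal.ofReal_sum_of_nonneg
      (fun Q _ => div_nonneg (Finset.sum_nonneg fun s _ => y.nonneg Q s) y.total_pos.le),
      ← Finset.sum_div, y.total, div_self y.total_pos.ne', ENNReal.ofReal_one])

/-! ## The deletion process on a terminal spanning tree -/

/-- A state of the deletion process: the non-deleted edges of the terminal spanning tree, and the
terminal sets of the components sampled so far (the most recent one first). -/
abbrev State (V : Type*) : Type _ := Finset (Sym2 V) × List (Finset V)

/-- The edges `st.1` together with the sampled components.  Only the fact that a component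
connects its terminals is used, hence it is represented by a clique on them. -/
def State.graph {V : Type*} (st : State V) : SimpleGraph V :=
  SimpleGraph.fromRel fun u w => s(u, w) ∈ st.1 ∨ ∃ Q ∈ st.2, u ∈ Q ∧ w ∈ Q

/-- All the terminals are connected by the non-deleted edges and the sampled components. -/
def State.Connects {V : Type*} (R : Finset V) (st : State V) : Prop :=
  ∀ u ∈ R, ∀ w ∈ R, st.graph.Reachable u w

/-- A (raw) randomized procedure choosing the set of bridge edges to be deleted, given the current
state, the current LP solution and the terminal set of the component that has just been
sampled. -/
abbrev Procedure {V : Type*} [Fintype V] (R : Finset V) (ρ : V) (M : ℝ) : Type _ :=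
  State V → LPSolution R ρ M → Finset V → PMF (Finset (Sym2 V))

/-- The procedure only deletes non-deleted edges, and never disconnects the terminals once the
sampled component has been added. -/
def Procedure.Valid {V : Type*} [Fintype V] {R : Finset V} {ρ : V} {M : ℝ}
    (π : Procedure R ρ M) : Prop :=
  ∀ (st : State V) (y : LPSolution R ρ M) (Q : Finset V), ∀ B ∈ (π st y Q).support,
    B ⊆ st.1 ∧ (st.Connects R → State.Connects R (st.1 \ B, Q :: st.2))

/-- One iteration: take the LP solution `y st`, sample a component, and delete the bridge edges
chosen by the procedure. -/
def step {V : Type*} [Fintype V] {R : Finset V} {ρ : V} {M : ℝ} (π : Procedure R ρ M)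
    (y : State V → LPSolution R ρ M) (st : State V) : PMF (State V) :=
  (y st).sample.bind fun Q => (π st (y st) Q).map fun B => (st.1 \ B, Q :: st.2)

/-- The law of the state after `t` iterations, starting from the tree with edge set `T`. -/
def run {V : Type*} [Fintype V] {R : Finset V} {ρ : V} {M : ℝ} (π : Procedure R ρ M)
    (y : State V → LPSolution R ρ M) (T : Finset (Sym2 V)) : ℕ → PMF (State V)
  | 0 => PMF.pure (T, [])
  | t + 1 => (run π y T t).bind (step π y)

/-! ## The rooted binary tree

The Steiner tree is `S`; it is rooted by splitting its edge `ab`.  The edges at a vertex `v` are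
listed by `rank v`: the edge `vu` has rank `j` if it is the `(j + 1)`-st edge at `v`. -/

/-- `rank` lists, for every vertex, the incident edges in order of non-increasing cost. -/
def IsCostOrder {V : Type*} [Fintype V] (S : SimpleGraph V) [DecidableRel S.Adj]
    (c : Sym2 V → ℝ≥0) (rank : V → V → ℕ) : Prop :=
  ∀ v, Set.BijOn (rank v) (S.neighborSet v) (Set.Iio (S.degree v)) ∧
    ∀ u w, S.Adj v u → S.Adj v w → rank v u < rank v w → c s(v, w) ≤ c s(v, u)

/-- The distance of `v` from the split edge `ab`. -/
def depth {V : Type*} (S : SimpleGraph V) (a b v : V) : ℕ := min (S.dist a v) (S.dist b v)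

/-- The parent of `v` in `S` rooted at the split edge (for `v ≠ a, b`): the neighbour of `v` that
is closer to the root. -/
def parent {V : Type*} (S : SimpleGraph V) (a b v : V) : V :=
  if h : ∃ u, S.Adj v u ∧ depth S a b u < depth S a b v then h.choose else v

/-- The children of `v` in `S` rooted at the split edge. -/
def children {V : Type*} [Fintype V] (S : SimpleGraph V) (a b v : V) : Finset V :=
  univ.filter fun w => S.Adj v w ∧ depth S a b v < depth S a b w

/-- The position (from `0`) of `w` in the list of the children of its parent, the edges to the
children being listed in order of non-increasing cost. -/
def childIndex {V : Type*} [Fintype V] (S : SimpleGraph V) (a b : V) (rank : V → V → ℕ)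
    (w : V) : ℕ :=
  #{u ∈ children S a b (parent S a b w) | rank (parent S a b w) u < rank (parent S a b w) w}

/-- Nodes of the binary tree: `none` is the root, which splits the edge `ab`; `some (v, 0)` is the
vertex `v`, and `some (v, j)`, `j ≥ 1`, are the dummy nodes that split `v`. -/
abbrev Node (V : Type*) : Type _ := Option (V × ℕ)

/-- The parent of a node of the binary tree (the root is sent to itself).  A vertex `v` with
children `w₀, …, w_{k-1}` (most expensive edge first), `k ≥ 2`, is split into the downward path
`(v, 0), …, (v, k - 2)`; for `j < k - 2` the children of `(v, j)` are `w_j` and the dummy node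
`(v, j + 1)`, while the children of `(v, k - 2)` are `w_{k-2}` and `w_{k-1}`. -/
def nodeParent {V : Type*} [Fintype V] (S : SimpleGraph V) (a b : V) (rank : V → V → ℕ) :
    Node V → Node V
  | none => none
  | some (v, j + 1) => some (v, j)
  | some (w, 0) =>
    if w = a ∨ w = b then none
    else some (parent S a b w,
      min (childIndex S a b rank w) (#(children S a b (parent S a b w)) - 2))

/-- All the nodes of the binary tree. -/
def nodes {V : Type*} [Fintype V] (S : SimpleGraph V) (a b : V) : Finset (Node V) :=
  insert none ((univ.sigma fun v : V => range (max 1 (#(children S a b v) - 1))).image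
    fun p => some (p.1, p.2))

/-- The children of a node of the binary tree. -/
def nodeChildren {V : Type*} [Fintype V] (S : SimpleGraph V) (a b : V) (rank : V → V → ℕ)
    (n : Node V) : Finset (Node V) :=
  (nodes S a b).filter fun m => m ≠ none ∧ nodeParent S a b rank m = n

/-- The node `m` is `n` or an ancestor of `n`. -/
def IsAncestor {V : Type*} [Fintype V] (S : SimpleGraph V) (a b : V) (rank : V → V → ℕ)
    (m n : Node V) : Prop :=
  ∃ k : ℕ, (nodeParent S a b rank)^[k] n = m

/-- The edges on the path between the terminals `u` and `w` of the binary tree.  The edge that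
joins a node to its parent is represented by that node; it is on the path iff exactly one of the
two ends is below it. -/
def pathEdges {V : Type*} [Fintype V] (S : SimpleGraph V) (a b : V) (rank : V → V → ℕ)
    (u w : V) : Finset (Node V) :=
  (nodes S a b).filter fun m => m ≠ none ∧
    Xor (IsAncestor S a b rank m (some (u, 0))) (IsAncestor S a b rank m (some (w, 0)))

/-- A choice of one of the two child edges of every node that has two children.

Nodes with a single child (the vertices of `S` of degree `2`) are to be shortcut, which merges the
edge below such a node with the edge above it.  Here they are kept, as subdivisions of a single
edge: they make no choice, so that a merged edge is marked iff its topmost piece is, and a path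
between terminals contains a merged edge iff it contains one (equivalently, all) of its pieces. -/
abbrev Marking {V : Type*} [Fintype V] (S : SimpleGraph V) (a b : V) (rank : V → V → ℕ) : Type _ :=
  (n : {n : Node V // n ∈ nodes S a b ∧ #(nodeChildren S a b rank n) = 2}) →
    {m : Node V // m ∈ nodeChildren S a b rank n.1}

instance {V : Type*} [Fintype V] (S : SimpleGraph V) (a b : V) (rank : V → V → ℕ) :
    Finite (Marking S a b rank) := by
  have : Finite {n : Node V // n ∈ nodes S a b ∧ #(nodeChildren S a b rank n) = 2} :=
    Finite.of_injective (fun n => (⟨n.1, n.2.1⟩ : {n : Node V // n ∈ nodes S a b}))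
      (fun m n h => Subtype.ext (congrArg (fun z => z.1) h))
  exact Pi.finite

instance {V : Type*} [Fintype V] (S : SimpleGraph V) (a b : V) (rank : V → V → ℕ) :
    Fintype (Marking S a b rank) := Fintype.ofFinite _

/-- The edge above the node `m` is marked. -/
def IsMarked {V : Type*} [Fintype V] {S : SimpleGraph V} {a b : V} {rank : V → V → ℕ}
    (μ : Marking S a b rank) (m : Node V) : Prop := ∃ n, (μ n).1 = m

/-! ## The witness tree and the deletion of the edges of the Steiner tree -/

/-- The edges of the witness tree: `uw`, for terminals `u ≠ w`, such that the path between `u` and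
`w` in the binary tree contains exactly one marked edge. -/
def witnessTree {V : Type*} [Fintype V] {S : SimpleGraph V} {a b : V} {rank : V → V → ℕ}
    (R : Finset V) (μ : Marking S a b rank) : Finset (Sym2 V) :=
  univ.filter fun e => ∃ u w, e = s(u, w) ∧ u ∈ R ∧ w ∈ R ∧ u ≠ w ∧
    #{m ∈ pathEdges S a b rank u w | IsMarked μ m} = 1

/-- The edge of `S` from which the edge of the binary tree above the node `some (v, 0)`
originates. -/
def originalEdge {V : Type*} (S : SimpleGraph V) (a b v : V) : Sym2 V :=
  if v = a ∨ v = b then s(a, b) else s(v, parent S a b v)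

/-- The witness set of an edge `f` of `S`: the edges `uw` of the witness tree such that the path
between `u` and `w` in the binary tree contains the edge corresponding to `f` (for `f = ab` there
are two such edges, the two halves of `f`, and a path contains either both or none). -/
def witnessSet {V : Type*} [Fintype V] {S : SimpleGraph V} {a b : V} {rank : V → V → ℕ}
    (R : Finset V) (μ : Marking S a b rank) (f : Sym2 V) : Finset (Sym2 V) :=
  (witnessTree R μ).filter fun e => ∃ u w, e = s(u, w) ∧
    ∃ v, originalEdge S a b v = f ∧ some (v, 0) ∈ pathEdges S a b rank u w

/-- The edge `f` of `S` is not deleted as long as some edge of its witness set is not deleted. -/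
def Survives {V : Type*} [Fintype V] {S : SimpleGraph V} {a b : V} {rank : V → V → ℕ}
    (R : Finset V) (μ : Marking S a b rank) (st : State V) (f : Sym2 V) : Prop :=
  ∃ e ∈ witnessSet R μ f, e ∈ st.1

/-- For a fixed marking: the expected number of iterations at the beginning of which at least one
of the `i` first (most expensive) edges at `v` is not deleted. -/
def expectedTimeOf {V : Type*} [Fintype V] {S : SimpleGraph V} {a b : V} {rank : V → V → ℕ}
    {R : Finset V} {ρ : V} {M : ℝ} (π : Procedure R ρ M) (y : State V → LPSolution R ρ M)
    (μ : Marking S a b rank) (v : V) (i : ℕ) : ℝ≥0∞ :=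
  ∑' t : ℕ, (run π y (witnessTree R μ) t).toOuterMeasure
    {st | ∃ u, S.Adj v u ∧ rank v u < i ∧ Survives R μ st s(v, u)}

/-- The expected number of iterations before the `i` first (most expensive) edges at `v` are all
deleted, the marking being uniformly random. -/
def expectedTime {V : Type*} [Fintype V] (S : SimpleGraph V) (a b : V) (rank : V → V → ℕ)
    {R : Finset V} {ρ : V} {M : ℝ} (π : Procedure R ρ M) (y : State V → LPSolution R ρ M)
    (v : V) (i : ℕ) : ℝ≥0∞ :=
  (∑ μ : Marking S a b rank, expectedTimeOf π y μ v i) / (Fintype.card (Marking S a b rank) : ℝ≥0∞)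

/-! ## The bound -/

/-- The bound `2⁻ⁱ M H_i + (1 - 2⁻ⁱ) ∑_{q ≥ 1} 2^{-q} M H_{q+i}`. -/
def bound (M : ℝ) (i : ℕ) : ℝ :=
  1 / 2 ^ i * (M * harmonic i) +
    (1 - 1 / 2 ^ i) * ∑' q : ℕ, 1 / 2 ^ (q + 1) * (M * harmonic (q + 1 + i))

end MinPower

end

/-!
The procedure deletes every edge of the terminal tree with probability at least `1 / M` per
iteration, and the witness sets of the first `i` edges at a vertex are small on average.

*Deletion.* Let `T` be a minimal set of non-deleted edges that still connects the terminals.  For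
edge costs `c ≥ 0`, a sampled component makes some edges of `T` redundant; the most expensive such
set is found greedily, and by Abel summation its cost is controlled by the number of components of
`T` minus its `j` most expensive edges that the sampled component touches (`exists_redundant`).
Adding up the cut constraints for these components (`card_le_sum_touched`) shows that the expected
cost is at least `c(T) / M`.  As this holds for all `c`, a minimax argument (`exists_weights`)
yields one randomized choice that deletes every edge with probability at least `1 / M`
(`exists_deletion`).  Then `M H_q`, where `q` is the number of non-deleted edges of a set `W`,
decreases by at least `1` per iteration on average until `q = 0` (`potential_drift`), so that the
expected time until `W` is deleted is at most `M H_{#W}` (`exists_procedure`).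

*Witnesses.* Every node of the binary tree is the top of a unique unmarked path to a terminal, and
the witness edges correspond to the marked edges: the one above `g` joins the ends of the unmarked
paths that start at `g` and at the parent of `g`. The path of this witness edge passes through the
edge above `m` iff the parent of `g` is a proper ancestor of `m` and the edges between `m` and it,
except possibly the topmost one, are unmarked; these `g` form `chain μ m`. Going up, every node with
two children ends the walk with probability `1 / 2`, whence `#(chain μ m)` is dominated by a
geometric random variable (`IsBinary.sum_harmonic_chain_le`). The first `i` edges at `v` have at
most `i` witnesses if all of them are marked child edges, and at most `i + #(chain μ v)` witnesses
otherwise; the choices below `v` are independent of the chain above `v` (`IsBinary.sum_allMarked`).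
If the edge towards the root is among the first `i` edges, or all the child edges are, there are at
most `i - 1 + #(chain μ v)` witnesses, which is no worse. Independence of the choices is expressed
by the involutions of `exists_flip`, which exchange the choice at a single node.
-/

open scoped NNReal ENNReal

noncomputable section

namespace MinPower

open Finset Classical

/-! ### Connections, cut constraints and redundant edges -/

section Bridge

variable {V : Type*}

theorem State.graph_adj {st : State V} {u w : V} :
    st.graph.Adj u w ↔ u ≠ w ∧ (s(u, w) ∈ st.1 ∨ ∃ Q ∈ st.2, u ∈ Q ∧ w ∈ Q) := by
  simp only [State.graph, SimpleGraph.fromRel_adj, Sym2.eq_swap (a := w) (b := u)]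
  constructor
  · rintro ⟨h, h' | h' | ⟨Q, hQ, h1, h2⟩⟩
    · exact ⟨h, h'⟩
    · exact ⟨h, Or.inl h'⟩
    · exact ⟨h, Or.inr ⟨Q, hQ, h2, h1⟩⟩
  · rintro ⟨h, h'⟩
    exact ⟨h, Or.inl h'⟩

theorem State.graph_mono {T T' : Finset (Sym2 V)} {L L' : List (Finset V)} (hT : T ⊆ T')
    (hL : L ⊆ L') : State.graph (T, L) ≤ State.graph (T', L') := by
  intro u w h
  rw [State.graph_adj] at h ⊢
  rcases h with ⟨h, h' | ⟨Q, hQ, h'⟩⟩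
  · exact ⟨h, Or.inl (hT h')⟩
  · exact ⟨h, Or.inr ⟨Q, hL hQ, h'⟩⟩

/-- The vertices `u` and `w` are connected by the edges `T` and the components `L`. -/
abbrev Linked (T : Finset (Sym2 V)) (L : List (Finset V)) (u w : V) : Prop :=
  (State.graph (T, L)).Reachable u w

theorem Linked.mono {T T' : Finset (Sym2 V)} {L L' : List (Finset V)} {u w : V}
    (h : Linked T L u w) (hT : T ⊆ T') (hL : L ⊆ L') : Linked T' L' u w :=
  SimpleGraph.Reachable.mono (State.graph_mono hT hL) h

theorem linked_of_mem {T : Finset (Sym2 V)} {L : List (Finset V)} {u w : V}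
    (h : s(u, w) ∈ T) : Linked T L u w := by
  by_cases huw : u = w
  · subst huw; exact SimpleGraph.Reachable.refl _
  · exact SimpleGraph.Adj.reachable (State.graph_adj.2 ⟨huw, Or.inl h⟩)

theorem linked_of_mem_component {T : Finset (Sym2 V)} {L : List (Finset V)} {Q : Finset V}
    (hQ : Q ∈ L) {u w : V} (hu : u ∈ Q) (hw : w ∈ Q) : Linked T L u w := by
  by_cases huw : u = w
  · subst huw; exact SimpleGraph.Reachable.refl _
  · exact SimpleGraph.Adj.reachable (State.graph_adj.2 ⟨huw, Or.inr ⟨Q, hQ, hu, hw⟩⟩)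

/-- A connection that uses the edge `uw` at all can be made to use it exactly once. -/
theorem Linked.of_insert {T : Finset (Sym2 V)} {L : List (Finset V)} {u w x y : V}
    (h : Linked (insert s(u, w) T) L x y) :
    Linked T L x y ∨ (Linked T L x u ∧ Linked T L w y) ∨ (Linked T L x w ∧ Linked T L u y) := by
  obtain ⟨p⟩ := h
  induction p with
  | nil => exact Or.inl (SimpleGraph.Reachable.refl _)
  | @cons x z y hxz p ih =>
    rw [State.graph_adj] at hxz
    obtain ⟨hne, h⟩ := hxz
    by_cases he : s(x, z) = s(u, w)
    · have hr : ∀ v, Linked T L v v := fun v => SimpleGraph.Reachable.refl _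
      rcases Sym2.eq_iff.1 he with ⟨rfl, rfl⟩ | ⟨rfl, rfl⟩
      · rcases ih with ih | ih | ih
        · exact Or.inr (Or.inl ⟨hr _, ih⟩)
        · exact Or.inr (Or.inl ⟨hr _, ih.2⟩)
        · exact Or.inl ih.2
      · rcases ih with ih | ih | ih
        · exact Or.inr (Or.inr ⟨hr _, ih⟩)
        · exact Or.inl ih.2
        · exact Or.inr (Or.inr ⟨hr _, ih.2⟩)
    · have hxz : Linked T L x z := by
        refine SimpleGraph.Adj.reachable (State.graph_adj.2 ⟨hne, ?_⟩)
        rcases h with h | h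
        · rcases Finset.mem_insert.1 h with h | h
          · exact absurd h he
          · exact Or.inl h
        · exact Or.inr h
      rcases ih with ih | ih | ih
      · exact Or.inl (hxz.trans ih)
      · exact Or.inr (Or.inl ⟨hxz.trans ih.1, ih.2⟩)
      · exact Or.inr (Or.inr ⟨hxz.trans ih.1, ih.2⟩)

/-- The number of connected components of the graph of `(T, L)` that meet `Q`. -/
def touched (T : Finset (Sym2 V)) (L : List (Finset V)) (Q : Finset V) : ℕ :=
  #(Q.image (State.graph (T, L)).connectedComponentMk)

/-- Removing an edge increases the number of touched components by at most one, and only if both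
ends of the edge are in touched components afterwards. -/
theorem touched_le_touched_insert (T : Finset (Sym2 V)) (L : List (Finset V)) (Q : Finset V)
    (u w : V) :
    touched T L Q ≤ touched (insert s(u, w) T) L Q +
      if (∃ q ∈ Q, Linked T L u q) ∧ (∃ q ∈ Q, Linked T L w q) then 1 else 0 := by
  set G := State.graph (T, L) with hG
  set G' := State.graph (insert s(u, w) T, L) with hG'
  have hle : G ≤ G' := State.graph_mono (Finset.subset_insert _ _) (List.Subset.refl _)
  let f : G.ConnectedComponent → G'.ConnectedComponent :=
    SimpleGraph.ConnectedComponent.map (SimpleGraph.Hom.ofLE hle)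
  have hf : ∀ x, f (G.connectedComponentMk x) = G'.connectedComponentMk x := fun x => rfl
  have himg : (Q.image G.connectedComponentMk).image f = Q.image G'.connectedComponentMk := by
    rw [Finset.image_image]; rfl
  split_ifs with h
  · have hinj : Set.InjOn f
        ((Q.image G.connectedComponentMk).erase (G.connectedComponentMk u)) := by
      intro c hc d hd hcd
      simp only [Finset.coe_erase, Finset.coe_image, Set.mem_sdiff, Set.mem_image, Finset.mem_coe,
        Set.mem_singleton_iff] at hc hd
      obtain ⟨⟨x, hx, rfl⟩, hxu⟩ := hc
      obtain ⟨⟨y, hy, rfl⟩, hyu⟩ := hd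
      rw [hf, hf, SimpleGraph.ConnectedComponent.eq] at hcd
      rw [SimpleGraph.ConnectedComponent.eq] at hxu hyu ⊢
      rcases Linked.of_insert hcd with h | h | h
      · exact h
      · exact absurd h.1 hxu
      · exact absurd h.2.symm hyu
    have h1 := Finset.card_image_of_injOn hinj
    have h2 : #(((Q.image G.connectedComponentMk).erase (G.connectedComponentMk u)).image f) ≤
        touched (insert s(u, w) T) L Q := by
      refine Finset.card_le_card ?_
      rw [← himg]
      exact Finset.image_subset_image (Finset.erase_subset _ _)
    have h3 := Finset.pred_card_le_card_erase (s := Q.image G.connectedComponentMk)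
      (a := G.connectedComponentMk u)
    have h4 : touched T L Q = #(Q.image G.connectedComponentMk) := rfl
    omega
  · have hinj : Set.InjOn f (Q.image G.connectedComponentMk) := by
      intro c hc d hd hcd
      simp only [Finset.coe_image, Set.mem_image, Finset.mem_coe] at hc hd
      obtain ⟨x, hx, rfl⟩ := hc
      obtain ⟨y, hy, rfl⟩ := hd
      rw [hf, hf, SimpleGraph.ConnectedComponent.eq] at hcd
      rw [SimpleGraph.ConnectedComponent.eq]
      rcases Linked.of_insert hcd with h' | h' | h'
      · exact h'
      · exact absurd ⟨⟨x, hx, h'.1.symm⟩, ⟨y, hy, h'.2⟩⟩ h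
      · exact absurd ⟨⟨y, hy, h'.2⟩, ⟨x, hx, h'.1.symm⟩⟩ h
    have h1 := Finset.card_image_of_injOn hinj
    rw [himg] at h1
    exact h1.ge

/-- The sides of two bridges that are away from `ρ` are not connected once both bridges are
removed. -/
theorem not_linked_far_ends {T E : Finset (Sym2 V)} {L : List (Finset V)} {ρ : V}
    {e e' : Sym2 V} (he : e ∈ E) (he' : e' ∈ E) (heT : e ∈ T) (heT' : e' ∈ T) (hne : e ≠ e')
    {x x' : V} (hx : x ∈ e) (hx' : x' ∈ e') (hρ : ¬ Linked (T.erase e) L ρ x)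
    (hρ' : ¬ Linked (T.erase e') L ρ x') (hconn : Linked T L ρ x) : ¬ Linked (T \ E) L x x' := by
  intro hxx
  obtain ⟨n, rfl⟩ := hx
  obtain ⟨n', rfl⟩ := hx'
  have hLL := List.Subset.refl L
  have h1 : Linked (T.erase s(x, n)) L ρ n := by
    rw [← Finset.insert_erase heT] at hconn
    rcases hconn.of_insert with h | h | h
    · exact absurd h hρ
    · exact absurd h.1 hρ
    · exact h.1
  have hsub : T \ E ⊆ T.erase s(x, n) := fun f hf =>
    Finset.mem_erase.2 ⟨fun h => (Finset.mem_sdiff.1 hf).2 (h ▸ he), (Finset.mem_sdiff.1 hf).1⟩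
  have hsub' : T \ E ⊆ T.erase s(x', n') := fun f hf =>
    Finset.mem_erase.2 ⟨fun h => (Finset.mem_sdiff.1 hf).2 (h ▸ he'), (Finset.mem_sdiff.1 hf).1⟩
  have hmem : s(x', n') ∈ T.erase s(x, n) := Finset.mem_erase.2 ⟨hne.symm, heT'⟩
  have hmem' : s(x, n) ∈ T.erase s(x', n') := Finset.mem_erase.2 ⟨hne, heT⟩
  have hsub2 : (T.erase s(x, n)).erase s(x', n') ⊆ T.erase s(x', n') :=
    Finset.erase_subset_erase _ (Finset.erase_subset _ _)
  have hsub3 := Finset.erase_subset s(x', n') (T.erase s(x, n))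
  have h2 := h1
  rw [← Finset.insert_erase hmem] at h2
  -- either `ρ` reaches the near end of one bridge without using the other bridge, and then the far
  -- end of the other bridge without using that bridge, or it reaches the far end `x'` directly
  rcases h2.of_insert with h | h | h
  · exact hρ' (((h.mono hsub2 hLL).trans (linked_of_mem hmem').symm).trans
      (hxx.mono hsub' hLL))
  · exact hρ' (h.1.mono hsub2 hLL)
  · exact hρ (((h.1.mono hsub3 hLL).trans (linked_of_mem hmem).symm).trans
      (hxx.mono hsub hLL).symm)

theorem State.Connects.insert_component {R : Finset V} {T : Finset (Sym2 V)} {L : List (Finset V)}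
    (h : State.Connects R (T, L)) (Q : Finset V) : State.Connects R (T, Q :: L) :=
  fun u hu w hw => Linked.mono (h u hu w hw) (Finset.Subset.refl _) (List.subset_cons_self _ _)

variable [Fintype V] {R : Finset V} {ρ : V} {M : ℝ}

/-- `M` times the probability that the sampled component has the terminal set `Q`. -/
def LPSolution.weight (y : LPSolution R ρ M) (Q : Finset V) : ℝ := ∑ s ∈ Q, y.x Q s

theorem LPSolution.weight_nonneg (y : LPSolution R ρ M) (Q : Finset V) : 0 ≤ y.weight Q :=
  Finset.sum_nonneg fun s _ => y.nonneg Q s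

theorem LPSolution.weight_eq_zero (y : LPSolution R ρ M) {Q : Finset V} (hQ : ¬ Q ⊆ R) :
    y.weight Q = 0 :=
  Finset.sum_eq_zero fun s _ => y.support Q s fun h => hQ h.2

/-- The cut constraints for the components that arise when the bridges `E` are removed from `T`
show that, on average, a sampled component touches `#E + 1` of them. -/
theorem card_le_sum_touched (y : LPSolution R ρ M) (hρ : ρ ∈ R) {T E : Finset (Sym2 V)}
    {L : List (Finset V)} (hT : ∀ e ∈ T, ∀ v ∈ e, v ∈ R) (hconn : State.Connects R (T, L))
    (hmin : ∀ e ∈ T, ¬ State.Connects R (T.erase e, L)) (hE : E ⊆ T) :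
    (#E : ℝ) ≤ ∑ Q, y.weight Q * ((touched (T \ E) L Q : ℝ) - 1) := by
  have : Nonempty V := ⟨ρ⟩
  -- by minimality every edge of `T` is a bridge; `f e` is its end on the side away from `ρ`
  have hfar : ∀ e ∈ T, ∃ x ∈ e, ¬ Linked (T.erase e) L ρ x := by
    intro e he
    by_contra! hcon
    apply hmin e he
    intro p hp q hq
    induction e with
    | _ u w =>
    have h0 := fun z hz => hconn ρ hρ z hz
    have hall : ∀ z ∈ R, Linked (T.erase s(u, w)) L ρ z := by
      intro z hz
      have := h0 z hz
      rw [← Finset.insert_erase he] at this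
      rcases Linked.of_insert this with h | h | h
      · exact h
      · exact (hcon w (Sym2.mem_mk_right _ _)).trans h.2
      · exact (hcon u (Sym2.mem_mk_left _ _)).trans h.2
    exact (hall p hp).symm.trans (hall q hq)
  choose! f hfe hfρ using hfar
  let W : Sym2 V → Finset V := fun e => R.filter fun z => Linked (T \ E) L (f e) z
  have hρW : ∀ e ∈ E, ¬ Linked (T \ E) L (f e) ρ := by
    intro e he h
    refine hfρ e (hE he) (Linked.mono h.symm ?_ (List.Subset.refl _))
    exact fun g hg => Finset.mem_erase.2
      ⟨fun h => (Finset.mem_sdiff.1 hg).2 (h ▸ he), (Finset.mem_sdiff.1 hg).1⟩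
  have hcut : ∀ e ∈ E, 1 ≤ ∑ Q with (Q ∩ W e).Nonempty, ∑ s ∈ Q with s ∉ W e, y.x Q s := by
    intro e he
    refine y.cut (W e) ⟨f e, ?_⟩ ?_
    · exact Finset.mem_filter.2 ⟨hT e (hE he) _ (hfe e (hE he)), SimpleGraph.Reachable.refl _⟩
    · intro z hz
      have hz := Finset.mem_filter.1 hz
      exact Finset.mem_erase.2 ⟨fun h => hρW e he (h ▸ hz.2), hz.1⟩
  calc (#E : ℝ) = ∑ e ∈ E, (1 : ℝ) := by simp
    _ ≤ ∑ e ∈ E, ∑ Q with (Q ∩ W e).Nonempty, ∑ s ∈ Q with s ∉ W e, y.x Q s :=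
        Finset.sum_le_sum hcut
    _ = ∑ e ∈ E, ∑ Q, ∑ s ∈ Q, if (Q ∩ W e).Nonempty ∧ s ∉ W e then y.x Q s else 0 := by
        refine Finset.sum_congr rfl fun e _ => ?_
        rw [Finset.sum_filter]
        refine Finset.sum_congr rfl fun Q _ => ?_
        split_ifs with h
        · rw [Finset.sum_filter]
          simp [h]
        · simp [h]
    _ = ∑ Q, ∑ s ∈ Q, ∑ e ∈ E, if (Q ∩ W e).Nonempty ∧ s ∉ W e then y.x Q s else 0 := by
        rw [Finset.sum_comm]
        exact Finset.sum_congr rfl fun Q _ => Finset.sum_comm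
    _ ≤ ∑ Q, y.weight Q * ((touched (T \ E) L Q : ℝ) - 1) := by
        refine Finset.sum_le_sum fun Q _ => ?_
        rw [LPSolution.weight, Finset.sum_mul]
        refine Finset.sum_le_sum fun s hs => ?_
        rw [← Finset.sum_filter, Finset.sum_const, nsmul_eq_mul, mul_comm]
        by_cases hQ : Q ⊆ R
        swap
        · rw [y.support Q s fun h => hQ h.2]; simp
        refine mul_le_mul_of_nonneg_left ?_ (y.nonneg Q s)
        set G := State.graph (T \ E, L) with hG
        have hcard : #{e ∈ E | (Q ∩ W e).Nonempty ∧ s ∉ W e} ≤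
            #((Q.image G.connectedComponentMk).erase (G.connectedComponentMk s)) := by
          refine Finset.card_le_card_of_injOn (fun e => G.connectedComponentMk (f e)) ?_ ?_
          · intro e he
            obtain ⟨-, ⟨z, hz⟩, hsW⟩ := Finset.mem_filter.1 he
            obtain ⟨hzQ, hzW⟩ := Finset.mem_inter.1 hz
            simp only [Finset.coe_erase, Finset.coe_image, Set.mem_sdiff, Set.mem_image,
              Finset.mem_coe, Set.mem_singleton_iff, SimpleGraph.ConnectedComponent.eq]
            exact ⟨⟨z, hzQ, (Finset.mem_filter.1 hzW).2.symm⟩,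
              fun h => hsW (Finset.mem_filter.2 ⟨hQ hs, h⟩)⟩
          · intro e he e' he' hee
            have he := (Finset.mem_filter.1 he).1
            have he' := (Finset.mem_filter.1 he').1
            by_contra hne
            refine not_linked_far_ends he he' (hE he) (hE he') hne (hfe e (hE he))
              (hfe e' (hE he')) (hfρ e (hE he)) (hfρ e' (hE he')) ?_
              (SimpleGraph.ConnectedComponent.eq.1 hee)
            exact hconn ρ hρ _ (hT e (hE he) _ (hfe e (hE he)))
        rw [Finset.card_erase_of_mem (Finset.mem_image_of_mem _ hs)] at hcard
        have hpos : 0 < #(Q.image G.connectedComponentMk) :=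
          Finset.card_pos.2 ⟨_, Finset.mem_image_of_mem _ hs⟩
        have h4 : touched (T \ E) L Q = #(Q.image G.connectedComponentMk) := rfl
        have : #{e ∈ E | (Q ∩ W e).Nonempty ∧ s ∉ W e} + 1 ≤ touched (T \ E) L Q := by omega
        have : (#{e ∈ E | (Q ∩ W e).Nonempty ∧ s ∉ W e} : ℝ) + 1 ≤ touched (T \ E) L Q := by
          exact_mod_cast this
        linarith

/-- The bridge lemma: for all non-negative edge costs `c`, a maximum-cost set of edges that the
sampled component makes redundant has an expected cost of at least `c(T) / M`.  The set is found
greedily, in order of non-increasing cost; by Abel summation it suffices to count the chosen edges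
among the `j` most expensive ones, for all `j`. -/
theorem exists_redundant (y : LPSolution R ρ M) (hρ : ρ ∈ R) {T : Finset (Sym2 V)}
    {L : List (Finset V)} (hT : ∀ e ∈ T, ∀ v ∈ e, v ∈ R) (hconn : State.Connects R (T, L))
    (hmin : ∀ e ∈ T, ¬ State.Connects R (T.erase e, L)) (c : Sym2 V → ℝ)
    (hc : ∀ e ∈ T, 0 ≤ c e) :
    ∃ B : Finset V → Finset (Sym2 V), (∀ Q, B Q ⊆ T ∧ State.Connects R (T \ B Q, Q :: L)) ∧
      ∑ e ∈ T, c e ≤ ∑ Q, y.weight Q * ∑ e ∈ B Q, c e := by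
  -- `E` consists of the most expensive edges; the new edge `uw` is chosen for `Q` iff removing it
  -- splits a component of `T \ E` into two parts that both contain a vertex of `Q`
  have key : ∀ E : Finset (Sym2 V), E ⊆ T → ∃ B : Finset V → Finset (Sym2 V),
      (∀ Q, B Q ⊆ E ∧ State.Connects R (T \ B Q, Q :: L)) ∧
      (∀ Q, Q ⊆ R → touched (T \ E) L Q ≤ #(B Q) + 1) ∧
      ∀ m, (∀ e ∈ E, m ≤ c e) →
        ∑ e ∈ E, (c e - m) ≤ ∑ Q, y.weight Q * ∑ e ∈ B Q, (c e - m) := by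
    intro E
    induction E using Finset.induction_on_min_value c with
    | empty =>
      intro _
      refine ⟨fun _ => ∅, fun Q => ⟨Finset.Subset.refl _, ?_⟩, fun Q hQ => ?_, ?_⟩
      · simpa using hconn.insert_component Q
      · have : touched T L Q ≤ 1 := by
          refine Finset.card_le_one.2 ?_
          intro p hp q hq
          obtain ⟨x, hx, rfl⟩ := Finset.mem_image.1 hp
          obtain ⟨z, hz, rfl⟩ := Finset.mem_image.1 hq
          exact SimpleGraph.ConnectedComponent.eq.2 (hconn x (hQ hx) z (hQ hz))
        simpa using this
      · simp
    | insert a E haE hmin' ih =>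
      intro hET
      have haT : a ∈ T := hET (Finset.mem_insert_self _ _)
      have hET' : E ⊆ T := (Finset.subset_insert _ _).trans hET
      obtain ⟨B, hB, hcount, hsum⟩ := ih hET'
      induction a with
      | _ u w =>
      let hit : Finset V → Prop := fun Q => (∃ q ∈ Q, Linked (T \ insert s(u, w) E) L u q) ∧
        (∃ q ∈ Q, Linked (T \ insert s(u, w) E) L w q)
      let B' : Finset V → Finset (Sym2 V) := fun Q =>
        if hit Q then insert s(u, w) (B Q) else B Q
      have haB : ∀ Q, s(u, w) ∉ B Q := fun Q h => haE ((hB Q).1 h)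
      have hins : insert s(u, w) (T \ insert s(u, w) E) = T \ E := by
        ext e
        simp only [Finset.mem_insert, Finset.mem_sdiff]
        by_cases h : e = s(u, w)
        · subst h; simp [haT, haE]
        · simp [h]
      have hcount' : ∀ Q, Q ⊆ R → touched (T \ insert s(u, w) E) L Q ≤ #(B' Q) + 1 := by
        intro Q hQ
        have h1 := touched_le_touched_insert (T \ insert s(u, w) E) L Q u w
        rw [hins] at h1
        have h2 := hcount Q hQ
        by_cases h : hit Q
        · have : #(B' Q) = #(B Q) + 1 := by
            simp only [B', if_pos h]; exact Finset.card_insert_of_notMem (haB Q)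
          rw [if_pos h] at h1
          omega
        · have : #(B' Q) = #(B Q) := by simp only [B', if_neg h]
          rw [if_neg h] at h1
          omega
      have hB' : ∀ Q, B' Q ⊆ insert s(u, w) E := by
        intro Q
        by_cases h : hit Q
        · simp only [B', if_pos h]; exact Finset.insert_subset_insert _ (hB Q).1
        · simp only [B', if_neg h]; exact (hB Q).1.trans (Finset.subset_insert _ _)
      refine ⟨B', fun Q => ⟨hB' Q, ?_⟩, hcount', ?_⟩
      · by_cases h : hit Q
        swap
        · simp only [B', if_neg h]; exact (hB Q).2
        have hlow : ∀ {x z}, Linked (T \ insert s(u, w) E) L x z →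
            Linked (T \ B' Q) (Q :: L) x z := fun hl =>
          hl.mono (Finset.sdiff_subset_sdiff (Finset.Subset.refl _) (hB' Q))
            (List.subset_cons_self _ _)
        obtain ⟨⟨q, hq, hqu⟩, ⟨q', hq', hqw⟩⟩ := id h
        have huw : Linked (T \ B' Q) (Q :: L) u w :=
          ((hlow hqu).trans (linked_of_mem_component (by simp) hq hq')).trans (hlow hqw).symm
        have hins' : insert s(u, w) (T \ B' Q) = T \ B Q := by
          simp only [B', if_pos h]
          ext e
          simp only [Finset.mem_insert, Finset.mem_sdiff]
          by_cases h : e = s(u, w)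
          · subst h; simp [haT, haB]
          · simp [h]
        intro p hp z hz
        have h1 := (hB Q).2 p hp z hz
        rw [← hins'] at h1
        rcases Linked.of_insert h1 with h | h | h
        · exact h
        · exact (h.1.trans huw).trans h.2
        · exact (h.1.trans huw.symm).trans h.2
      · intro m hm
        have hma := hm s(u, w) (Finset.mem_insert_self _ _)
        have h1 := hsum (c s(u, w)) fun e he => hmin' e he
        have h2 := card_le_sum_touched y hρ hT hconn hmin hET
        have h3 : (#(insert s(u, w) E) : ℝ) ≤ ∑ Q, y.weight Q * #(B' Q) := by
          refine h2.trans (Finset.sum_le_sum fun Q _ => ?_)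
          by_cases hQ : Q ⊆ R
          · refine mul_le_mul_of_nonneg_left ?_ (y.weight_nonneg Q)
            have : (touched (T \ insert s(u, w) E) L Q : ℝ) ≤ #(B' Q) + 1 := by
              exact_mod_cast hcount' Q hQ
            linarith
          · simp [y.weight_eq_zero hQ]
        have h4 : ∀ Q, ∑ e ∈ B' Q, (c e - m) =
            ∑ e ∈ B Q, (c e - c s(u, w)) + (c s(u, w) - m) * #(B' Q) := by
          intro Q
          have : ∑ e ∈ B' Q, (c e - c s(u, w)) = ∑ e ∈ B Q, (c e - c s(u, w)) := by
            by_cases h : hit Q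
            · simp only [B', if_pos h]; rw [Finset.sum_insert (haB Q)]; simp
            · simp only [B', if_neg h]
          rw [← this, mul_comm, ← nsmul_eq_mul, ← Finset.sum_const, ← Finset.sum_add_distrib]
          exact Finset.sum_congr rfl fun e _ => by ring
        have h5 : ∑ e ∈ insert s(u, w) E, (c e - m) =
            ∑ e ∈ E, (c e - c s(u, w)) + (c s(u, w) - m) * #(insert s(u, w) E) := by
          have : ∑ e ∈ insert s(u, w) E, (c e - c s(u, w)) = ∑ e ∈ E, (c e - c s(u, w)) := by
            rw [Finset.sum_insert haE]; simp
          rw [← this, mul_comm, ← nsmul_eq_mul, ← Finset.sum_const, ← Finset.sum_add_distrib]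
          exact Finset.sum_congr rfl fun e _ => by ring
        rw [h5]
        simp only [h4, mul_add, Finset.sum_add_distrib]
        refine add_le_add h1 ?_
        calc (c s(u, w) - m) * (#(insert s(u, w) E) : ℝ)
            ≤ (c s(u, w) - m) * ∑ Q, y.weight Q * #(B' Q) :=
              mul_le_mul_of_nonneg_left h3 (sub_nonneg.2 hma)
          _ = _ := by
              rw [Finset.mul_sum]
              exact Finset.sum_congr rfl fun Q _ => by ring
  obtain ⟨B, hB, -, hsum⟩ := key T (Finset.Subset.refl _)
  exact ⟨B, hB, by simpa using hsum 0 hc⟩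

end Bridge

/-- A finite minimax theorem, by separation of the convex hull of the rows of `A` from an
orthant. -/
theorem exists_weights {κ ι : Type*} [Fintype κ] [Fintype ι] (A : κ → ι → ℝ) (τ : ℝ)
    (h : ∀ c : ι → ℝ, (∀ i, 0 ≤ c i) → ∃ β, τ * ∑ i, c i ≤ ∑ i, c i * A β i) :
    ∃ p : κ → ℝ, (∀ β, 0 ≤ p β) ∧ ∑ β, p β = 1 ∧ ∀ i, τ ≤ ∑ β, p β * A β i := by
  by_contra! hcon
  have hdisj : Disjoint (convexHull ℝ (Set.range A)) {z : ι → ℝ | ∀ i, τ ≤ z i} := by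
    rw [Set.disjoint_left]
    intro z hz hz'
    rw [convexHull_range_eq_exists_affineCombination] at hz
    obtain ⟨s, w, hw0, hw1, rfl⟩ := hz
    rw [Finset.affineCombination_eq_linear_combination _ _ _ hw1] at hz'
    obtain ⟨i, hi⟩ := hcon (fun β => if β ∈ s then w β else 0)
      (fun β => by split_ifs with hβ <;> simp [hw0, hβ]) (by simpa using hw1)
    have := hz' i
    simp only [Finset.sum_apply, Pi.smul_apply, smul_eq_mul] at this
    simp only [ite_mul, zero_mul, Finset.sum_ite_mem, Finset.univ_inter] at hi
    linarith
  have hclosed : IsClosed {z : ι → ℝ | ∀ i, τ ≤ z i} := by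
    simp only [Set.ofPred_forall]
    exact isClosed_iInter fun i => isClosed_le continuous_const (continuous_apply i)
  have hconv : Convex ℝ {z : ι → ℝ | ∀ i, τ ≤ z i} := by
    intro x hx z hz a b ha hb hab i
    have := add_le_add (mul_le_mul_of_nonneg_left (hx i) ha) (mul_le_mul_of_nonneg_left (hz i) hb)
    rw [← add_mul, hab, one_mul] at this
    exact this
  obtain ⟨f, u, v, hu, huv, hv⟩ := geometric_hahn_banach_compact_closed (convex_convexHull ℝ _)
    ((Set.finite_range A).isCompact_convexHull ℝ) hconv hclosed hdisj
  have hf : ∀ z : ι → ℝ, f z = ∑ i, f (Pi.single i 1) * z i := by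
    intro z
    conv_lhs => rw [← Finset.univ_sum_single z, map_sum]
    refine Finset.sum_congr rfl fun i _ => ?_
    rw [mul_comm, ← smul_eq_mul, ← map_smul, ← Pi.single_smul, smul_eq_mul, mul_one]
  -- `f` is bounded below on the orthant, so its coefficients cannot be negative
  have hpos : ∀ i, 0 ≤ f (Pi.single i 1) := by
    intro i
    by_contra! hneg
    obtain ⟨n, hn⟩ := exists_nat_gt ((f (fun _ => τ) - v) / (-f (Pi.single i 1)))
    rw [div_lt_iff₀ (by linarith)] at hn
    have := hv ((fun _ => τ) + (n : ℝ) • Pi.single i 1) (by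
      intro j
      simp only [Pi.add_apply, Pi.smul_apply, smul_eq_mul, le_add_iff_nonneg_right]
      refine mul_nonneg (Nat.cast_nonneg n) ?_
      by_cases hij : j = i
      · subst hij; simp
      · simp [hij])
    rw [map_add, map_smul, smul_eq_mul] at this
    linarith
  obtain ⟨β, hβ⟩ := h _ hpos
  have h1 := hu (A β) (subset_convexHull ℝ _ ⟨β, rfl⟩)
  have h2 := hv (fun _ => τ) fun _ => le_refl _
  rw [hf] at h1 h2
  rw [← Finset.sum_mul] at h2
  linarith

/-! ### Expectations with respect to a probability mass function -/

section Expectation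

/-- The expected value of `g`. -/
def expect {α : Type*} (p : PMF α) (g : α → ℝ≥0∞) : ℝ≥0∞ := ∑' a, p a * g a

variable {α β : Type*}

theorem expect_bind (p : PMF α) (f : α → PMF β) (g : β → ℝ≥0∞) :
    expect (p.bind f) g = expect p fun a => expect (f a) g := by
  simp only [expect, PMF.bind_apply, ← ENNReal.tsum_mul_right, ← ENNReal.tsum_mul_left]
  rw [ENNReal.tsum_comm]
  simp only [mul_assoc]

theorem expect_pure (a : α) (g : α → ℝ≥0∞) : expect (PMF.pure a) g = g a := by
  rw [expect, tsum_eq_single a]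
  · simp
  · intro b hb; simp [hb]

theorem expect_map (p : PMF α) (f : α → β) (g : β → ℝ≥0∞) :
    expect (p.map f) g = expect p (g ∘ f) := by
  rw [PMF.map, expect_bind]
  simp only [Function.comp_apply, expect_pure]
  rfl

theorem expect_mono {p : PMF α} {g g' : α → ℝ≥0∞} (h : ∀ a ∈ p.support, g a ≤ g' a) :
    expect p g ≤ expect p g' := by
  refine ENNReal.tsum_le_tsum fun a => ?_
  by_cases ha : a ∈ p.support
  · exact mul_le_mul_right (h a ha) _
  · rw [(PMF.apply_eq_zero_iff p a).2 ha]; simp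

theorem expect_add (p : PMF α) (g g' : α → ℝ≥0∞) :
    expect p (fun a => g a + g' a) = expect p g + expect p g' := by
  simp only [expect, mul_add, ENNReal.tsum_add]

theorem expect_const (p : PMF α) (x : ℝ≥0∞) : expect p (fun _ => x) = x := by
  simp only [expect, ENNReal.tsum_mul_right, p.tsum_coe, one_mul]

theorem expect_mul_left (p : PMF α) (x : ℝ≥0∞) (g : α → ℝ≥0∞) :
    expect p (fun a => x * g a) = x * expect p g := by
  simp only [expect, ← ENNReal.tsum_mul_left, mul_left_comm]

theorem expect_sum {ι : Type*} (p : PMF α) (s : Finset ι) (g : ι → α → ℝ≥0∞) :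
    expect p (fun a => ∑ i ∈ s, g i a) = ∑ i ∈ s, expect p (g i) := by
  simp only [expect, Finset.mul_sum]
  rw [Summable.tsum_finsetSum fun _ _ => ENNReal.summable]

theorem expect_indicator (p : PMF α) (s : Set α) :
    expect p (s.indicator 1) = p.toOuterMeasure s := by
  rw [PMF.toOuterMeasure_apply, expect]
  refine tsum_congr fun a => ?_
  by_cases ha : a ∈ s <;> simp [ha]

end Expectation

/-! ### The deletion procedure -/

section Deletion

variable {V : Type*}

/-- The states for which the deletion procedure does anything: the terminals are connected, and
the edges join distinct terminals. -/
def State.Good (R : Finset V) (st : State V) : Prop :=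
  st.Connects R ∧ ∀ e ∈ st.1, ¬ e.IsDiag ∧ ∀ v ∈ e, v ∈ R

theorem exists_minimal_connects {R : Finset V} {st : State V} (h : st.Connects R) :
    ∃ T ⊆ st.1, State.Connects R (T, st.2) ∧ ∀ e ∈ T, ¬ State.Connects R (T.erase e, st.2) := by
  obtain ⟨T, hT, hmin⟩ := Finset.exists_min_image
    (st.1.powerset.filter fun T => State.Connects R (T, st.2)) (fun T => #T)
    ⟨st.1, Finset.mem_filter.2 ⟨Finset.mem_powerset_self _, h⟩⟩
  rw [Finset.mem_filter, Finset.mem_powerset] at hT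
  refine ⟨T, hT.1, hT.2, fun e he hcon => ?_⟩
  have h1 := hmin (T.erase e) (Finset.mem_filter.2
    ⟨Finset.mem_powerset.2 ((Finset.erase_subset _ _).trans hT.1), hcon⟩)
  have h2 := Finset.card_erase_lt_of_mem he
  omega

variable [Fintype V] {R : Finset V} {ρ : V} {M : ℝ}

theorem LPSolution.one_le (y : LPSolution R ρ M) (h : (R.erase ρ).Nonempty) : 1 ≤ M := by
  refine (y.cut _ h (Finset.Subset.refl _)).trans ?_
  refine le_of_le_of_eq ((Finset.sum_le_sum fun Q _ => ?_).trans
    (Finset.sum_le_sum_of_subset_of_nonneg (Finset.filter_subset _ _)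
      fun Q _ _ => y.weight_nonneg Q)) y.total
  exact Finset.sum_le_sum_of_subset_of_nonneg (Finset.filter_subset _ _) fun s _ _ => y.nonneg Q s

theorem LPSolution.sample_apply (y : LPSolution R ρ M) (Q : Finset V) :
    y.sample Q = ENNReal.ofReal (y.weight Q / M) := rfl

/-- Since for all edge costs some choice of redundant edges is good enough on average, the minimax
theorem gives a distribution over such choices for which every single edge is deleted with
probability at least `1 / M`.  Edges that are redundant anyway are deleted with certainty. -/
theorem exists_deletion (hρ : ρ ∈ R) {st : State V} (hst : st.Good R) (y : LPSolution R ρ M) :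
    ∃ P : Finset V → PMF (Finset (Sym2 V)),
      (∀ Q, ∀ B ∈ (P Q).support, B ⊆ st.1 ∧ State.Connects R (st.1 \ B, Q :: st.2)) ∧
      ∀ e ∈ st.1, ENNReal.ofReal (1 / M) ≤
        expect y.sample fun Q => (P Q).toOuterMeasure {B | e ∈ B} := by
  obtain ⟨T, hTst, hconn, hmin⟩ := exists_minimal_connects hst.1
  have hTR : ∀ e ∈ T, ∀ v ∈ e, v ∈ R := fun e he => (hst.2 e (hTst he)).2
  let κ := {β : Finset V → Finset (Sym2 V) //
    ∀ Q, β Q ⊆ T ∧ State.Connects R (T \ β Q, Q :: st.2)}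
  let A : κ → {e // e ∈ T} → ℝ := fun β e => ∑ Q, y.weight Q * if e.1 ∈ β.1 Q then 1 else 0
  obtain ⟨p, hp0, hp1, hp⟩ := exists_weights A 1 (by
    intro c hc
    let c' : Sym2 V → ℝ := fun e => if h : e ∈ T then c ⟨e, h⟩ else 0
    have hcc' : c = fun i => c' i.1 := by
      funext i; simp [c', i.2]
    obtain ⟨B, hB, hsum⟩ := exists_redundant y hρ hTR hconn hmin c'
      (fun e he => by simp [c', he, hc])
    refine ⟨⟨B, hB⟩, ?_⟩
    rw [one_mul, hcc']
    refine le_trans (le_of_eq ?_) (hsum.trans (le_of_eq ?_))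
    · exact Finset.sum_coe_sort T c'
    · simp only [A, Finset.mul_sum]
      rw [Finset.sum_comm]
      refine Finset.sum_congr rfl fun Q _ => ?_
      rw [Finset.sum_coe_sort T fun e => c' e * (y.weight Q * if e ∈ B Q then 1 else 0),
        ← Finset.sum_subset (hB Q).1]
      · exact Finset.sum_congr rfl fun e he => by simp [he, mul_comm]
      · intro e _ he; simp [he])
  let p' : PMF κ := PMF.ofFintype (fun β => ENNReal.ofReal (p β)) (by
    rw [← ENNReal.ofReal_sum_of_nonneg fun β _ => hp0 β, hp1, ENNReal.ofReal_one])
  refine ⟨fun Q => p'.map fun β => (st.1 \ T) ∪ β.1 Q, ?_, ?_⟩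
  · intro Q B hB
    rw [PMF.support_map] at hB
    obtain ⟨β, -, rfl⟩ := hB
    refine ⟨Finset.union_subset Finset.sdiff_subset ((β.2 Q).1.trans hTst), ?_⟩
    have : st.1 \ (st.1 \ T ∪ β.1 Q) = T \ β.1 Q := by
      ext e
      have := @hTst e
      simp only [Finset.mem_sdiff, Finset.mem_union]
      tauto
    rw [this]
    exact (β.2 Q).2
  · intro e he
    have hM : 1 ≤ M := by
      refine y.one_le ?_
      obtain ⟨hd, hv⟩ := hst.2 e he
      induction e with
      | _ u w =>
      rw [Sym2.mk_isDiag_iff] at hd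
      by_cases huρ : u = ρ
      · exact ⟨w, Finset.mem_erase.2 ⟨fun h => hd (huρ.trans h.symm), hv w (by simp)⟩⟩
      · exact ⟨u, Finset.mem_erase.2 ⟨huρ, hv u (by simp)⟩⟩
    have hM0 : 0 < M := by linarith
    by_cases heT : e ∈ T
    · have h1 : ∀ Q, ENNReal.ofReal (∑ β, p β * if e ∈ β.1 Q then 1 else 0) ≤
          (p'.map fun β => (st.1 \ T) ∪ β.1 Q).toOuterMeasure {B | e ∈ B} := by
        intro Q
        rw [PMF.toOuterMeasure_map_apply, PMF.toOuterMeasure_apply_fintype,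
          ENNReal.ofReal_sum_of_nonneg fun β _ => mul_nonneg (hp0 β) (by split_ifs <;> simp)]
        refine Finset.sum_le_sum fun β _ => ?_
        by_cases h : e ∈ β.1 Q
        · rw [Set.indicator_of_mem (by simp [h])]
          simp [h, p']
        · simp [h]
      have h2 : 1 / M ≤ ∑ Q, y.weight Q / M * ∑ β, p β * if e ∈ β.1 Q then 1 else 0 := by
        have := hp ⟨e, heT⟩
        have h3 : ∑ Q, y.weight Q / M * ∑ β, (p β * if e ∈ β.1 Q then 1 else 0) =
            (∑ β, p β * A β ⟨e, heT⟩) / M := by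
          simp only [A, Finset.mul_sum, Finset.sum_div]
          rw [Finset.sum_comm]
          refine Finset.sum_congr rfl fun β _ => Finset.sum_congr rfl fun Q _ => ?_
          ring
        rw [h3]
        gcongr
      refine (ENNReal.ofReal_le_ofReal h2).trans ?_
      have hn : ∀ Q, 0 ≤ ∑ β, p β * if e ∈ β.1 Q then (1 : ℝ) else 0 := fun Q =>
        Finset.sum_nonneg fun β _ => mul_nonneg (hp0 β) (by split_ifs <;> simp)
      rw [ENNReal.ofReal_sum_of_nonneg fun Q _ =>
        mul_nonneg (div_nonneg (y.weight_nonneg Q) hM0.le) (hn Q), expect, tsum_fintype]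
      refine Finset.sum_le_sum fun Q _ => ?_
      rw [ENNReal.ofReal_mul (div_nonneg (y.weight_nonneg Q) hM0.le), y.sample_apply]
      exact mul_le_mul_right (h1 Q) _
    · have h1 : ∀ Q, (p'.map fun β => (st.1 \ T) ∪ β.1 Q).toOuterMeasure {B | e ∈ B} = 1 := by
        intro Q
        rw [PMF.toOuterMeasure_apply_eq_one_iff]
        intro B hB
        rw [PMF.support_map] at hB
        obtain ⟨β, -, rfl⟩ := hB
        exact Finset.mem_union_left _ (Finset.mem_sdiff.2 ⟨he, heT⟩)
      simp only [h1, expect_const]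
      rw [ENNReal.ofReal_le_one, div_le_one hM0]
      exact hM

theorem harmonic_cast_mono : Monotone fun n : ℕ => (harmonic n : ℝ) :=
  monotone_nat_of_le_succ fun n => by
    rw [harmonic_succ]
    push_cast
    have : (0 : ℝ) ≤ ((n : ℝ) + 1)⁻¹ := by positivity
    linarith

theorem harmonic_cast_nonneg (n : ℕ) : (0 : ℝ) ≤ harmonic n := by
  simpa using harmonic_cast_mono (Nat.zero_le n)

theorem div_add_harmonic_le (r n : ℕ) : (n : ℝ) / (r + n : ℕ) + harmonic r ≤ harmonic (r + n) := by
  induction n with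
  | zero => simp
  | succ n ih =>
    rw [← add_assoc, harmonic_succ]
    push_cast at ih ⊢
    have hpos : (0 : ℝ) < r + n + 1 := by positivity
    have h1 : (n : ℝ) / (r + n + 1) ≤ n / (r + n) := by
      rcases Nat.eq_zero_or_pos n with h | h
      · simp [h]
      · have : (0 : ℝ) < n := by exact_mod_cast h
        exact div_le_div_of_nonneg_left this.le (by positivity) (by linarith)
    rw [add_div, inv_eq_one_div]
    linarith

/-- The potential of the deletion process with respect to a set `W` of edges. -/
def potential (M : ℝ) (W : Finset (Sym2 V)) (st : State V) : ℝ≥0∞ :=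
  ENNReal.ofReal (M * harmonic #(W ∩ st.1))

/-- If every non-deleted edge is deleted with probability at least `1 / M`, then the potential
decreases by at least `1` on average while some edge of `W` is non-deleted. -/
theorem potential_drift (hM : 0 < M) {π : Procedure R ρ M} {y : State V → LPSolution R ρ M}
    {st : State V} (hπ : ∀ e ∈ st.1, ENNReal.ofReal (1 / M) ≤
      expect (y st).sample fun Q => (π st (y st) Q).toOuterMeasure {B | e ∈ B})
    (W : Finset (Sym2 V)) :
    {st : State V | ∃ e ∈ W, e ∈ st.1}.indicator 1 st + expect (step π y st) (potential M W) ≤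
      potential M W st := by
  rw [step, expect_bind]
  simp only [expect_map]
  set q := #(W ∩ st.1) with hq
  have hpt : ∀ B : Finset (Sym2 V), ENNReal.ofReal (M / q) * (#((W ∩ st.1) ∩ B) : ℕ) +
      potential M W (st.1 \ B, []) ≤ potential M W st := by
    intro B
    rw [potential, potential, ← ENNReal.ofReal_natCast, ← ENNReal.ofReal_mul (by positivity),
      ← ENNReal.ofReal_add (by positivity)
        (mul_nonneg hM.le (harmonic_cast_nonneg _))]
    refine ENNReal.ofReal_le_ofReal ?_
    have h1 : #((W ∩ st.1) ∩ B) + #(W ∩ (st.1 \ B)) = q := by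
      rw [hq, ← Finset.card_inter_add_card_sdiff (W ∩ st.1) B, Finset.inter_sdiff_assoc]
    have h2 := div_add_harmonic_le #(W ∩ (st.1 \ B)) #((W ∩ st.1) ∩ B)
    rw [add_comm #(W ∩ (st.1 \ B)), h1] at h2
    calc M / q * #((W ∩ st.1) ∩ B) + M * harmonic #(W ∩ (st.1 \ B))
        = M * (#((W ∩ st.1) ∩ B) / q + harmonic #(W ∩ (st.1 \ B))) := by ring
      _ ≤ M * harmonic q := mul_le_mul_of_nonneg_left h2 hM.le
  have hsum : ∑ e ∈ W ∩ st.1, ENNReal.ofReal (1 / M) ≤ expect (y st).sample fun Q =>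
      expect (π st (y st) Q) fun B => (#((W ∩ st.1) ∩ B) : ℕ) := by
    calc ∑ e ∈ W ∩ st.1, ENNReal.ofReal (1 / M)
        ≤ ∑ e ∈ W ∩ st.1, expect (y st).sample fun Q =>
          (π st (y st) Q).toOuterMeasure {B | e ∈ B} :=
          Finset.sum_le_sum fun e he => hπ e (Finset.mem_inter.1 he).2
      _ = expect (y st).sample fun Q => expect (π st (y st) Q) fun B =>
          ∑ e ∈ W ∩ st.1, {B : Finset (Sym2 V) | e ∈ B}.indicator 1 B := by
          simp only [expect_sum, expect_indicator]
      _ = _ := by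
          congr 1; funext Q; congr 1; funext B
          simp only [Set.indicator_apply, Set.mem_ofPred_eq, Pi.one_apply, Finset.sum_boole]
          rw [Finset.filter_mem_eq_inter]
  rw [Finset.sum_const, nsmul_eq_mul, ← hq] at hsum
  have hind : {st : State V | ∃ e ∈ W, e ∈ st.1}.indicator 1 st ≤ expect (y st).sample fun Q =>
      expect (π st (y st) Q) fun B => ENNReal.ofReal (M / q) * (#((W ∩ st.1) ∩ B) : ℕ) := by
    by_cases h : ∃ e ∈ W, e ∈ st.1
    · have hqpos : 0 < q := by
        obtain ⟨e, he, he'⟩ := h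
        exact Finset.card_pos.2 ⟨e, Finset.mem_inter.2 ⟨he, he'⟩⟩
      rw [Set.indicator_of_mem (by exact h)]
      simp only [expect_mul_left]
      refine le_trans (le_of_eq ?_) (mul_le_mul_right hsum _)
      have : (0 : ℝ) < q := by exact_mod_cast hqpos
      rw [← ENNReal.ofReal_natCast, ← ENNReal.ofReal_mul (by positivity),
        ← ENNReal.ofReal_mul (by positivity), Pi.one_apply, ← ENNReal.ofReal_one]
      congr 1
      field_simp
    · rw [Set.indicator_of_notMem (by exact h)]
      exact bot_le
  refine (add_le_add_left hind _).trans ?_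
  rw [← expect_add]
  simp only [← expect_add]
  calc _ ≤ expect (y st).sample fun Q => expect (π st (y st) Q) fun _ => potential M W st :=
        expect_mono fun Q _ => expect_mono fun B _ => hpt B
    _ = _ := by simp only [expect_const]

/-- A valid procedure for which the expected time until a fixed set `W` of edges is deleted is at
most `M H_{#W}`. -/
theorem exists_procedure (hρ : ρ ∈ R) (hM : 0 < M) :
    ∃ π : Procedure R ρ M, π.Valid ∧ ∀ (y : State V → LPSolution R ρ M) (T : Finset (Sym2 V)),
      State.Good R (T, []) → ∀ W : Finset (Sym2 V),
        ∑' t : ℕ, (run π y T t).toOuterMeasure {st | ∃ e ∈ W, e ∈ st.1} ≤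
          ENNReal.ofReal (M * harmonic #W) := by
  let π : Procedure R ρ M := fun st y Q =>
    if h : st.Good R then (exists_deletion hρ h y).choose Q else PMF.pure ∅
  have hgood : ∀ st : State V, st.Good R → ∀ y Q, π st y Q =
      if h : st.Good R then (exists_deletion hρ h y).choose Q else PMF.pure ∅ :=
    fun _ _ _ _ => rfl
  have hvalid : π.Valid := by
    intro st y Q B hB
    by_cases h : st.Good R
    · rw [hgood st h, dif_pos h] at hB
      have := (exists_deletion hρ h y).choose_spec.1 Q B hB
      exact ⟨this.1, fun _ => this.2⟩
    · have hB : B ∈ (PMF.pure (∅ : Finset (Sym2 V))).support := by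
        simpa only [π, dif_neg h] using hB
      rw [PMF.support_pure, Set.mem_singleton_iff] at hB
      subst hB
      exact ⟨Finset.empty_subset _, fun h => by simpa using State.Connects.insert_component h Q⟩
  refine ⟨π, hvalid, fun y T hT W => ?_⟩
  have hrun : ∀ t, ∀ st ∈ (run π y T t).support, st.Good R := by
    intro t
    induction t with
    | zero =>
      intro st hst
      rw [run, PMF.support_pure, Set.mem_singleton_iff] at hst
      rwa [hst]
    | succ t ih =>
      intro st hst
      rw [run, PMF.mem_support_bind_iff] at hst
      obtain ⟨st', hst', hst⟩ := hst
      rw [step, PMF.mem_support_bind_iff] at hst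
      obtain ⟨Q, -, hst⟩ := hst
      rw [PMF.support_map] at hst
      obtain ⟨B, hB, rfl⟩ := hst
      have h := ih st' hst'
      exact ⟨(hvalid st' _ Q B hB).2 h.1, fun e he => h.2 e (Finset.mem_sdiff.1 he).1⟩
  have hpart : ∀ n, ∑ t ∈ Finset.range n, (run π y T t).toOuterMeasure {st | ∃ e ∈ W, e ∈ st.1} +
      expect (run π y T n) (potential M W) ≤ potential M W (T, []) := by
    intro n
    induction n with
    | zero => simp [run, expect_pure]
    | succ n ih =>
      refine le_trans ?_ ih
      rw [Finset.sum_range_succ, add_assoc]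
      refine add_le_add_right ?_ _
      rw [run, expect_bind, ← expect_indicator, ← expect_add]
      refine expect_mono fun st hst => potential_drift hM (fun e he => ?_) W
      have h := hrun n st hst
      have := (exists_deletion hρ h (y st)).choose_spec.2 e he
      simpa only [hgood st h, dif_pos h] using this
  rw [ENNReal.tsum_eq_iSup_nat]
  refine iSup_le fun n => (le_self_add.trans (hpart n)).trans ?_
  refine ENNReal.ofReal_le_ofReal (mul_le_mul_of_nonneg_left ?_ hM.le)
  have hmono : #(W ∩ T) ≤ #W := Finset.card_le_card Finset.inter_subset_left
  exact harmonic_cast_mono hmono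

end Deletion

/-! ### The tree rooted at the split edge -/

section RootedTree

variable {V : Type*} {S : SimpleGraph V} {a b : V}

/-- A neighbour of `v` that is closer to `x` is the next vertex on the path from `v` to `x`. -/
theorem eq_of_dist_lt (hS : S.IsTree) {x v u u' : V} (hu : S.Adj v u) (hu' : S.Adj v u')
    (hd : S.dist x u < S.dist x v) (hd' : S.dist x u' < S.dist x v) : u = u' := by
  obtain ⟨p, hp, hpl⟩ := hS.connected.exists_path_of_dist x v
  have key : ∀ {z}, S.Adj v z → S.dist x z < S.dist x v → z = p.penultimate := by
    intro z hz hdz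
    refine hS.isAcyclic.eq_penultimate_of_adj_end hp hz ?_
    by_contra hsupp
    obtain ⟨q, hq, hql⟩ := hS.connected.exists_path_of_dist x z
    have hv := hS.isAcyclic.mem_support_of_ne_mem_support_of_adj_of_isPath hq hp hz.symm hsupp
    have := congrArg SimpleGraph.Walk.length (hS.isAcyclic.path_concat hp hq hz hv)
    rw [SimpleGraph.Walk.length_concat] at this
    omega
  rw [key hu hd, key hu' hd']

theorem depth_comm (v : V) : depth S a b v = depth S b a v := min_comm _ _

theorem depth_left : depth S a b a = 0 := by simp [depth]

theorem depth_right : depth S a b b = 0 := by simp [depth]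

theorem depth_pos (hS : S.IsTree) {v : V} (hva : v ≠ a) (hvb : v ≠ b) : 0 < depth S a b v :=
  lt_min (hS.connected.pos_dist_of_ne hva.symm) (hS.connected.pos_dist_of_ne hvb.symm)

/-- A vertex off the split edge has exactly one neighbour that is not farther from that edge.  If
`a` is the closer end, this neighbour is on the path to `a`, hence also on the path to `b`. -/
theorem exists_closer (hS : S.IsTree) (hab : S.Adj a b) {v : V} (hva : v ≠ a) (hvb : v ≠ b) :
    ∃ u, S.Adj v u ∧ depth S a b u < depth S a b v ∧
      ∀ u', S.Adj v u' → u' ≠ u → depth S a b v < depth S a b u' := by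
  wlog hlt : S.dist b v = S.dist a v + 1 generalizing a b
  · have h := hS.dist_eq_dist_add_one_of_adj v hab
    rw [SimpleGraph.dist_comm, SimpleGraph.dist_comm (v := b)] at h
    simp only [depth_comm (a := a) (b := b)]
    exact this hab.symm hvb hva (by omega)
  have hpos := hS.connected.pos_dist_of_ne (Ne.symm hva)
  obtain ⟨p, hp, hpl⟩ := hS.connected.exists_path_of_dist a v
  have hnil : ¬ p.Nil := by
    rw [← SimpleGraph.Walk.length_eq_zero_iff]; omega
  have hadj : S.Adj v p.penultimate := (p.adj_penultimate hnil).symm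
  have hdu : S.dist a p.penultimate < S.dist a v := by
    have h1 := SimpleGraph.dist_le p.dropLast
    have h2 : p.dropLast.length + 1 = p.length := SimpleGraph.Walk.length_dropLast_add_one hnil
    omega
  have hduv := hS.dist_eq_dist_add_one_of_adj a hadj
  have hba : S.dist b p.penultimate ≤ S.dist a p.penultimate + 1 := by
    have := hS.connected.dist_triangle (u := b) (v := a) (w := p.penultimate)
    rw [SimpleGraph.dist_eq_one_iff_adj.2 hab.symm] at this
    omega
  refine ⟨p.penultimate, hadj, ?_, fun u' hu' hne => ?_⟩
  · simp only [depth]; omega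
  · have h1 : ¬ S.dist a u' < S.dist a v := fun h => hne (eq_of_dist_lt hS hu' hadj h hdu)
    have h2 : ¬ S.dist b u' < S.dist b v := fun h =>
      hne (eq_of_dist_lt hS hu' hadj h (by omega))
    have h3 := hS.dist_eq_dist_add_one_of_adj a hu'
    simp only [depth]; omega

/-- The neighbour of `v` in the direction of the split edge; for `v = a` and `v = b` the other
end of that edge. -/
def upNeighbor (S : SimpleGraph V) (a b v : V) : V :=
  if v = a then b else if v = b then a else parent S a b v

theorem parent_spec (hS : S.IsTree) (hab : S.Adj a b) {v : V} (hva : v ≠ a) (hvb : v ≠ b) :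
    S.Adj v (parent S a b v) ∧ depth S a b (parent S a b v) < depth S a b v := by
  obtain ⟨u, hu, hd, -⟩ := exists_closer hS hab hva hvb
  have h : ∃ u, S.Adj v u ∧ depth S a b u < depth S a b v := ⟨u, hu, hd⟩
  rw [parent, dif_pos h]
  exact h.choose_spec

theorem upNeighbor_eq_root (hS : S.IsTree) (hab : S.Adj a b) {u v : V}
    (hu : u = upNeighbor S a b v) (hv : v = upNeighbor S a b u) : v = a ∨ v = b := by
  by_contra hcon
  push Not at hcon
  have h1 := (parent_spec hS hab hcon.1 hcon.2).2
  have hu' : u = parent S a b v := by rw [hu, upNeighbor, if_neg hcon.1, if_neg hcon.2]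
  rw [← hu'] at h1
  by_cases hua : u = a
  · rw [upNeighbor, if_pos hua] at hv; exact hcon.2 hv
  by_cases hub : u = b
  · rw [upNeighbor, if_neg hua, if_pos hub] at hv; exact hcon.1 hv
  have h2 := (parent_spec hS hab hua hub).2
  rw [upNeighbor, if_neg hua, if_neg hub] at hv
  rw [← hv] at h2
  omega

theorem originalEdge_eq (v : V) : originalEdge S a b v = s(v, upNeighbor S a b v) := by
  unfold originalEdge upNeighbor
  by_cases h1 : v = a
  · simp [h1]
  · by_cases h2 : v = b
    · subst h2; simp [h1, Sym2.eq_swap]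
    · simp [h1, h2]

variable [Fintype V]

theorem mem_children {v w : V} :
    w ∈ children S a b v ↔ S.Adj v w ∧ depth S a b v < depth S a b w := by
  simp [children]

theorem ne_of_mem_children {v w : V} (h : w ∈ children S a b v) : w ≠ a ∧ w ≠ b := by
  have := (mem_children.1 h).2
  constructor
  · rintro rfl; rw [depth_left] at this; omega
  · rintro rfl; rw [depth_right] at this; omega

theorem parent_eq (hS : S.IsTree) (hab : S.Adj a b) {v w : V} (h : w ∈ children S a b v) :
    parent S a b w = v := by
  obtain ⟨hwa, hwb⟩ := ne_of_mem_children h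
  obtain ⟨u, hu, hd, huniq⟩ := exists_closer hS hab hwa hwb
  obtain ⟨h1, h2⟩ := parent_spec hS hab hwa hwb
  rw [mem_children] at h
  have h3 : parent S a b w = u := by
    by_contra hne; have := huniq _ h1 hne; omega
  have h4 : v = u := by
    by_contra hne; have := huniq _ h.1.symm hne; omega
  rw [h3, h4]

theorem mem_children_parent (hS : S.IsTree) (hab : S.Adj a b) {w : V} (hwa : w ≠ a)
    (hwb : w ≠ b) : w ∈ children S a b (parent S a b w) := by
  obtain ⟨h1, h2⟩ := parent_spec hS hab hwa hwb
  exact mem_children.2 ⟨h1.symm, h2⟩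

theorem upNeighbor_notMem (hS : S.IsTree) (hab : S.Adj a b) (v : V) :
    upNeighbor S a b v ∉ children S a b v := by
  rw [mem_children]
  unfold upNeighbor
  split_ifs with h1 h2
  · rw [depth_right]; omega
  · rw [depth_left]; omega
  · have := (parent_spec hS hab h1 h2).2; omega

theorem adj_iff (hS : S.IsTree) (hab : S.Adj a b) (v u : V) :
    S.Adj v u ↔ u = upNeighbor S a b v ∨ u ∈ children S a b v := by
  rw [mem_children]
  unfold upNeighbor
  split_ifs with h1 h2
  · subst h1
    rw [depth_left]
    constructor
    · intro h
      by_cases hub : u = b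
      · exact Or.inl hub
      · exact Or.inr ⟨h, depth_pos hS h.ne' hub⟩
    · rintro (rfl | h)
      exacts [hab, h.1]
  · subst h2
    rw [depth_right]
    constructor
    · intro h
      by_cases hub : u = a
      · exact Or.inl hub
      · exact Or.inr ⟨h, depth_pos hS hub h.ne'⟩
    · rintro (rfl | h)
      exacts [hab.symm, h.1]
  · obtain ⟨u₀, hu₀, hd, huniq⟩ := exists_closer hS hab h1 h2
    obtain ⟨h3, h4⟩ := parent_spec hS hab h1 h2
    have h5 : parent S a b v = u₀ := by
      by_contra hne; have := huniq _ h3 hne; omega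
    constructor
    · intro h
      by_cases hne : u = u₀
      · exact Or.inl (hne.trans h5.symm)
      · exact Or.inr ⟨h, huniq u h hne⟩
    · rintro (rfl | h)
      exacts [h3, h.1]

theorem degree_eq [DecidableRel S.Adj] (hS : S.IsTree) (hab : S.Adj a b) (v : V) :
    S.degree v = #(children S a b v) + 1 := by
  rw [← Finset.card_insert_of_notMem (upNeighbor_notMem hS hab v),
    ← S.card_neighborFinset_eq_degree]
  congr 1
  ext u
  rw [SimpleGraph.mem_neighborFinset, adj_iff hS hab, Finset.mem_insert]

end RootedTree

/-! ### Positions in a list ordered by rank -/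

section Index

variable {α : Type*} (C : Finset α) (f : α → ℕ)

theorem card_filter_lt_lt {x y : α} (hx : x ∈ C) (hxy : f x < f y) :
    #{u ∈ C | f u < f x} < #{u ∈ C | f u < f y} := by
  refine Finset.card_lt_card (Finset.ssubset_iff_of_subset ?_ |>.2 ⟨x, ?_, ?_⟩)
  · intro u hu
    simp only [Finset.mem_filter] at hu ⊢
    exact ⟨hu.1, hu.2.trans hxy⟩
  · simp [hx, hxy]
  · simp

theorem injOn_card_filter_lt (hf : Set.InjOn f C) :
    Set.InjOn (fun x => #{u ∈ C | f u < f x}) C := by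
  intro x hx y hy hxy
  rcases lt_trichotomy (f x) (f y) with h | h | h
  · have := card_filter_lt_lt C f hx h; simp only at hxy; omega
  · exact hf hx hy h
  · have := card_filter_lt_lt C f hy h; simp only at hxy; omega

theorem card_filter_lt_lt_card {x : α} (hx : x ∈ C) : #{u ∈ C | f u < f x} < #C :=
  Finset.card_lt_card (Finset.filter_ssubset.2 ⟨x, hx, by simp⟩)

theorem exists_card_filter_lt_eq (hf : Set.InjOn f C) {j : ℕ} (hj : j < #C) :
    ∃ x ∈ C, #{u ∈ C | f u < f x} = j := by
  have := Finset.surjOn_of_injOn_of_card_le (s := C) (t := Finset.range #C)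
    (fun x => #{u ∈ C | f u < f x})
    (fun x hx => by simpa using card_filter_lt_lt_card C f hx) (injOn_card_filter_lt C f hf)
    (by simp)
  obtain ⟨x, hx, h⟩ := this (Finset.mem_coe.2 (Finset.mem_range.2 hj))
  exact ⟨x, hx, h⟩

end Index

/-! ### The structure of the binary tree -/

section Binary

variable {V : Type*} [Fintype V] {S : SimpleGraph V} {a b : V} {rank : V → V → ℕ}

theorem childIndex_eq (hS : S.IsTree) (hab : S.Adj a b) {v w : V} (h : w ∈ children S a b v) :
    childIndex S a b rank w = #{u ∈ children S a b v | rank v u < rank v w} := by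
  rw [childIndex, parent_eq hS hab h]

theorem childIndex_lt (hS : S.IsTree) (hab : S.Adj a b) {v w : V} (h : w ∈ children S a b v) :
    childIndex S a b rank w < #(children S a b v) := by
  rw [childIndex_eq hS hab h]
  exact card_filter_lt_lt_card _ _ h

theorem mem_nodes {v : V} {j : ℕ} :
    some (v, j) ∈ nodes S a b ↔ j < max 1 (#(children S a b v) - 1) := by
  simp only [nodes, Finset.mem_insert, reduceCtorEq, Finset.mem_image, Finset.mem_sigma,
    Finset.mem_univ, Finset.mem_range, true_and, Option.some.injEq, Prod.mk.injEq, Sigma.exists,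
    false_or]
  constructor
  · rintro ⟨v', j', h, rfl, rfl⟩; exact h
  · exact fun h => ⟨v, j, h, rfl, rfl⟩

theorem none_mem_nodes : none ∈ nodes S a b := by simp [nodes]

theorem zero_mem_nodes (v : V) : some (v, 0) ∈ nodes S a b := mem_nodes.2 (by simp)

theorem nodeParent_child (hS : S.IsTree) (hab : S.Adj a b) {v w : V}
    (h : w ∈ children S a b v) : nodeParent S a b rank (some (w, 0)) =
      some (v, min (childIndex S a b rank w) (#(children S a b v) - 2)) := by
  have := ne_of_mem_children h
  simp [nodeParent, this.1, this.2, parent_eq hS hab h]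

theorem nodeParent_root {w : V} (h : w = a ∨ w = b) :
    nodeParent S a b rank (some (w, 0)) = none := by
  simp [nodeParent, h]

/-- A rank function of the binary tree: the nodes are ordered by the depth of the vertex from which
they originate and, for the same vertex, by their position `j`, which is at most the number of
vertices. -/
def level (S : SimpleGraph V) (a b : V) : Node V → ℕ
  | none => 0
  | some (v, j) => depth S a b v * (Fintype.card V + 1) + j + 1

theorem nodeParent_cases (hS : S.IsTree) (hab : S.Adj a b) (w : V) :
    ((w = a ∨ w = b) ∧ nodeParent S a b rank (some (w, 0)) = none) ∨
    ∃ v, w ∈ children S a b v ∧ nodeParent S a b rank (some (w, 0)) =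
      some (v, min (childIndex S a b rank w) (#(children S a b v) - 2)) := by
  by_cases h : w = a ∨ w = b
  · exact Or.inl ⟨h, nodeParent_root h⟩
  · push Not at h
    have := mem_children_parent hS hab h.1 h.2
    exact Or.inr ⟨_, this, nodeParent_child hS hab this⟩

theorem level_nodeParent_lt (hS : S.IsTree) (hab : S.Adj a b) {n : Node V} (hn : n ≠ none) :
    level S a b (nodeParent S a b rank n) < level S a b n := by
  match n, hn with
  | some (v, j + 1), _ => simp [nodeParent, level]
  | some (w, 0), _ =>
    rcases nodeParent_cases (rank := rank) hS hab w with ⟨-, h⟩ | ⟨v, hw, h⟩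
    · simp [h, level]
    · rw [h]
      simp only [level]
      have h1 := (mem_children.1 hw).2
      have h2 := Finset.card_le_univ (children S a b v)
      have h3 : min (childIndex S a b rank w) (#(children S a b v) - 2) < Fintype.card V + 1 := by
        omega
      have h4 : (depth S a b v + 1) * (Fintype.card V + 1) ≤
          depth S a b w * (Fintype.card V + 1) := Nat.mul_le_mul_right _ h1
      rw [add_mul] at h4
      omega

theorem nodeParent_mem (hS : S.IsTree) (hab : S.Adj a b) {n : Node V} (hn : n ∈ nodes S a b) :
    nodeParent S a b rank n ∈ nodes S a b := by
  match n, hn with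
  | none, h => exact h
  | some (v, j + 1), h =>
    rw [mem_nodes] at h
    exact mem_nodes.2 (by omega)
  | some (w, 0), h =>
    rcases nodeParent_cases (rank := rank) hS hab w with ⟨-, h⟩ | ⟨v, hw, h⟩
    · rw [h]; exact none_mem_nodes
    · rw [h]; exact mem_nodes.2 (by omega)

theorem mem_nodeChildren {n m : Node V} : m ∈ nodeChildren S a b rank n ↔
    m ∈ nodes S a b ∧ m ≠ none ∧ nodeParent S a b rank m = n := by
  simp [nodeChildren]

theorem mem_nodeChildren_of_childIndex (hS : S.IsTree) (hab : S.Adj a b) {v w : V} {j : ℕ}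
    (hw : w ∈ children S a b v)
    (hj : min (childIndex S a b rank w) (#(children S a b v) - 2) = j) :
    some (w, 0) ∈ nodeChildren S a b rank (some (v, j)) := by
  rw [mem_nodeChildren, nodeParent_child hS hab hw, hj]
  exact ⟨zero_mem_nodes w, by simp, rfl⟩

/-- The children of the node `(v, j)`: the next dummy node, if there is one, and the children of
`v` that hang below `(v, j)`. -/
theorem eq_of_mem_nodeChildren (hS : S.IsTree) (hab : S.Adj a b) {v : V} {j : ℕ} {m : Node V}
    (hm : m ∈ nodeChildren S a b rank (some (v, j))) :
    (m = some (v, j + 1) ∧ j + 2 < #(children S a b v)) ∨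
      ∃ w ∈ children S a b v, m = some (w, 0) ∧
        min (childIndex S a b rank w) (#(children S a b v) - 2) = j ∧
        childIndex S a b rank w < #(children S a b v) := by
  rw [mem_nodeChildren] at hm
  match m, hm with
  | some (v', j' + 1), h =>
    obtain ⟨h1, -, h2⟩ := h
    rw [nodeParent, Option.some.injEq, Prod.mk.injEq] at h2
    obtain ⟨rfl, rfl⟩ := h2
    rw [mem_nodes] at h1
    exact Or.inl ⟨rfl, by omega⟩
  | some (w, 0), h =>
    rcases nodeParent_cases (rank := rank) hS hab w with ⟨-, h'⟩ | ⟨v', hw, h'⟩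
    · rw [h'] at h; simp at h
    · obtain ⟨-, -, h2⟩ := h
      rw [h', Option.some.injEq, Prod.mk.injEq] at h2
      obtain ⟨rfl, h2⟩ := h2
      exact Or.inr ⟨w, hw, rfl, h2, childIndex_lt hS hab hw⟩

/-- What is used of the binary tree: its nodes have at most two children, those without children
are the terminals, and every non-root node has a level that exceeds that of its parent. -/
structure IsBinary (S : SimpleGraph V) (a b : V) (rank : V → V → ℕ) (R : Finset V) : Prop where
  level_lt : ∀ n : Node V, n ≠ none → level S a b (nodeParent S a b rank n) < level S a b n
  parent_mem : ∀ n ∈ nodes S a b, nodeParent S a b rank n ∈ nodes S a b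
  card_le : ∀ n ∈ nodes S a b, #(nodeChildren S a b rank n) ≤ 2
  leaf : ∀ n ∈ nodes S a b, nodeChildren S a b rank n = ∅ ↔ ∃ u ∈ R, n = some (u, 0)

variable [DecidableRel S.Adj] {c : Sym2 V → ℝ≥0}

theorem injOn_rank (hrank : IsCostOrder S c rank) (v : V) :
    Set.InjOn (rank v) (children S a b v) :=
  (hrank v).1.injOn.mono fun _ hu => (mem_children.1 hu).1

theorem childIndex_inj (hS : S.IsTree) (hab : S.Adj a b) (hrank : IsCostOrder S c rank)
    {v w w' : V} (h : w ∈ children S a b v) (h' : w' ∈ children S a b v)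
    (heq : childIndex S a b rank w = childIndex S a b rank w') : w = w' := by
  rw [childIndex_eq hS hab h, childIndex_eq hS hab h'] at heq
  exact injOn_card_filter_lt _ _ (injOn_rank hrank v) h h' heq

theorem exists_childIndex_eq (hS : S.IsTree) (hab : S.Adj a b) (hrank : IsCostOrder S c rank)
    {v : V} {j : ℕ} (hj : j < #(children S a b v)) :
    ∃ w ∈ children S a b v, childIndex S a b rank w = j := by
  obtain ⟨w, hw, h⟩ := exists_card_filter_lt_eq _ _ (injOn_rank hrank v) hj
  exact ⟨w, hw, by rw [childIndex_eq hS hab hw, h]⟩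

theorem card_nodeChildren_le (hS : S.IsTree) (hab : S.Adj a b) (hrank : IsCostOrder S c rank)
    {n : Node V} (hn : n ∈ nodes S a b) : #(nodeChildren S a b rank n) ≤ 2 := by
  match n, hn with
  | none, _ =>
    refine (Finset.card_le_card (t := {some (a, 0), some (b, 0)}) ?_).trans Finset.card_le_two
    intro m hm
    rw [mem_nodeChildren] at hm
    match m, hm with
    | some (v, j + 1), h => exact absurd h.2.2 (by simp [nodeParent])
    | some (w, 0), h =>
      rcases nodeParent_cases (rank := rank) hS hab w with ⟨h', -⟩ | ⟨v, hw, h'⟩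
      · simpa using h'
      · rw [h'] at h; simp at h
  | some (v, j), hn =>
    rw [mem_nodes] at hn
    -- the two children of a node are told apart by the index in the list of children
    let φ : Node V → ℕ := fun m => match m with
      | none => 0
      | some (_, _ + 1) => j + 1
      | some (w, 0) => childIndex S a b rank w
    have : #(nodeChildren S a b rank (some (v, j))) ≤ #({j, j + 1} : Finset ℕ) := by
      refine Finset.card_le_card_of_injOn φ ?_ ?_
      · intro m hm
        rcases eq_of_mem_nodeChildren hS hab hm with ⟨rfl, h⟩ | ⟨w, hw, rfl, h1, h2⟩
        · simp [φ]
        · simp only [φ, Finset.coe_insert, Finset.coe_singleton, Set.mem_insert_iff,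
            Set.mem_singleton_iff]
          omega
      · intro m hm m' hm' heq
        rcases eq_of_mem_nodeChildren hS hab hm with ⟨rfl, h⟩ | ⟨w, hw, rfl, h1, h2⟩ <;>
        rcases eq_of_mem_nodeChildren hS hab hm' with ⟨rfl, h'⟩ | ⟨w', hw', rfl, h1', h2'⟩
        · rfl
        · simp only [φ] at heq; omega
        · simp only [φ] at heq; omega
        · simp only [φ] at heq
          rw [childIndex_inj hS hab hrank hw hw' heq]
    exact this.trans Finset.card_le_two

/-- The node below which the child of index `j` hangs has two children, unless `j` is the last
index. -/
theorem card_nodeChildren_eq_two (hS : S.IsTree) (hab : S.Adj a b)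
    (hrank : IsCostOrder S c rank) {v : V} {j : ℕ} (hj : j + 1 < #(children S a b v)) :
    #(nodeChildren S a b rank (some (v, j))) = 2 := by
  refine le_antisymm (card_nodeChildren_le hS hab hrank
    (mem_nodes.2 (lt_max_of_lt_right (by omega)))) ?_
  obtain ⟨w, hw, hwj⟩ := exists_childIndex_eq hS hab hrank (v := v) (j := j) (by omega)
  have hmem : some (w, 0) ∈ nodeChildren S a b rank (some (v, j)) :=
    mem_nodeChildren_of_childIndex hS hab hw (by omega)
  refine Finset.one_lt_card.2 ⟨_, hmem, ?_⟩
  by_cases hj' : j + 2 < #(children S a b v)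
  · refine ⟨some (v, j + 1), ?_, by simp⟩
    rw [mem_nodeChildren]
    exact ⟨mem_nodes.2 (by omega), by simp, rfl⟩
  · obtain ⟨w', hw', hwj'⟩ := exists_childIndex_eq hS hab hrank hj
    refine ⟨some (w', 0), ?_, ?_⟩
    · exact mem_nodeChildren_of_childIndex hS hab hw' (by omega)
    · intro h
      simp only [Option.some.injEq, Prod.mk.injEq, and_true] at h
      subst h
      omega

theorem nodeChildren_eq_empty_iff (hS : S.IsTree) (hab : S.Adj a b)
    (hrank : IsCostOrder S c rank) {n : Node V} (hn : n ∈ nodes S a b) :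
    nodeChildren S a b rank n = ∅ ↔ ∃ u, S.degree u = 1 ∧ n = some (u, 0) := by
  constructor
  · intro h
    match n, hn with
    | none, _ =>
      have : some (a, 0) ∈ nodeChildren S a b rank none :=
        mem_nodeChildren.2 ⟨zero_mem_nodes a, by simp, nodeParent_root (Or.inl rfl)⟩
      rw [h] at this; simp at this
    | some (v, j), hn =>
      rw [mem_nodes] at hn
      have h1 : #(children S a b v) = 0 := by
        by_contra hk
        by_cases hj : j + 1 < #(children S a b v)
        · have := card_nodeChildren_eq_two hS hab hrank hj
          rw [h] at this; simp at this
        · obtain ⟨w, hw, hwj⟩ := exists_childIndex_eq hS hab hrank (v := v) (j := j) (by omega)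
          have hmem : some (w, 0) ∈ nodeChildren S a b rank (some (v, j)) :=
            mem_nodeChildren_of_childIndex hS hab hw (by omega)
          rw [h] at hmem; simp at hmem
      refine ⟨v, by rw [degree_eq hS hab, h1], ?_⟩
      congr 2; omega
  · rintro ⟨u, hu, rfl⟩
    rw [degree_eq hS hab] at hu
    have hc : #(children S a b u) = 0 := by omega
    rw [Finset.eq_empty_iff_forall_notMem]
    intro m hm
    rw [mem_nodeChildren] at hm
    match m, hm with
    | some (v, j + 1), h =>
      obtain ⟨h1, -, h2⟩ := h
      rw [nodeParent, Option.some.injEq, Prod.mk.injEq] at h2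
      obtain ⟨rfl, rfl⟩ := h2
      rw [mem_nodes] at h1
      omega
    | some (w, 0), h =>
      rcases nodeParent_cases (rank := rank) hS hab w with ⟨-, h'⟩ | ⟨v', hw, h'⟩
      · rw [h'] at h; simp at h
      · obtain ⟨-, -, h2⟩ := h
        rw [h', Option.some.injEq, Prod.mk.injEq] at h2
        obtain ⟨rfl, h2⟩ := h2
        exact absurd (Finset.card_eq_zero.1 hc) (Finset.ne_empty_of_mem hw)

theorem isBinary (hS : S.IsTree) (hab : S.Adj a b) (hrank : IsCostOrder S c rank)
    {R : Finset V} (hR : ∀ v, v ∈ R ↔ S.degree v = 1) : IsBinary S a b rank R where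
  level_lt _ hn := level_nodeParent_lt hS hab hn
  parent_mem _ hn := nodeParent_mem hS hab hn
  card_le _ hn := card_nodeChildren_le hS hab hrank hn
  leaf _ hn := by simp only [nodeChildren_eq_empty_iff hS hab hrank hn, hR]

end Binary

/-! ### Paths between terminals of the binary tree -/

section Paths

variable {V : Type*} [Fintype V] {S : SimpleGraph V} {a b : V} {rank : V → V → ℕ}

local notation "up" => nodeParent S a b rank

theorem iterate_nodeParent_none (k : ℕ) : up^[k] none = none := by
  induction k with
  | zero => rfl
  | succ k ih => rw [Function.iterate_succ_apply', ih]; rfl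

theorem IsAncestor.trans {l m n : Node V} (h : IsAncestor S a b rank l m)
    (h' : IsAncestor S a b rank m n) : IsAncestor S a b rank l n := by
  obtain ⟨j, rfl⟩ := h
  obtain ⟨k, rfl⟩ := h'
  exact ⟨j + k, Function.iterate_add_apply _ _ _ _⟩

theorem isAncestor_iterate {j k : ℕ} (h : j ≤ k) (n : Node V) :
    IsAncestor S a b rank (up^[k] n) (up^[j] n) :=
  ⟨k - j, by rw [← Function.iterate_add_apply]; congr 2; omega⟩

theorem pathEdges_comm (u w : V) : pathEdges S a b rank u w = pathEdges S a b rank w u := by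
  simp only [pathEdges, xor_comm]

variable {R : Finset V}

theorem IsBinary.level_le (hB : IsBinary S a b rank R) (n : Node V) :
    level S a b (up n) ≤ level S a b n := by
  by_cases h : n = none
  · subst h; rfl
  · exact (hB.level_lt n h).le

theorem IsBinary.level_ancestor_le (hB : IsBinary S a b rank R) {m n : Node V}
    (h : IsAncestor S a b rank m n) : level S a b m ≤ level S a b n := by
  obtain ⟨k, rfl⟩ := h
  induction k with
  | zero => exact le_refl _
  | succ k ih => rw [Function.iterate_succ_apply']; exact (hB.level_le _).trans ih

theorem IsBinary.level_iterate_succ_lt (hB : IsBinary S a b rank R) {n : Node V} (hn : n ≠ none)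
    (k : ℕ) : level S a b (up^[k + 1] n) < level S a b n := by
  rw [Function.iterate_succ_apply]
  exact (hB.level_ancestor_le ⟨k, rfl⟩).trans_lt (hB.level_lt n hn)

theorem IsBinary.iterate_mem (hB : IsBinary S a b rank R) {n : Node V} (hn : n ∈ nodes S a b)
    (k : ℕ) : up^[k] n ∈ nodes S a b := by
  induction k with
  | zero => exact hn
  | succ k ih => rw [Function.iterate_succ_apply']; exact hB.parent_mem _ ih

theorem IsBinary.isAncestor_none (hB : IsBinary S a b rank R) (n : Node V) :
    IsAncestor S a b rank none n := by
  induction h : level S a b n using Nat.strong_induction_on generalizing n with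
  | _ d ih =>
    subst h
    by_cases hn : n = none
    · subst hn; exact ⟨0, rfl⟩
    · exact (ih _ (hB.level_lt n hn) _ rfl).trans ⟨1, rfl⟩

theorem IsBinary.leaf_iterate_ne (hB : IsBinary S a b rank R) {u w : V} (hu : u ∈ R) (k : ℕ) :
    up^[k + 1] (some (w, 0)) ≠ some (u, 0) := by
  intro h
  rw [Function.iterate_succ_apply'] at h
  have hm : up^[k] (some (w, 0)) ∈ nodeChildren S a b rank (some (u, 0)) := by
    refine mem_nodeChildren.2 ⟨hB.iterate_mem (zero_mem_nodes w) k, fun h0 => ?_, h⟩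
    rw [h0] at h
    simp [nodeParent] at h
  rw [(hB.leaf _ (zero_mem_nodes u)).2 ⟨u, hu, rfl⟩] at hm
  simp at hm

/-- Two terminals have a lowest common ancestor; `p` and `q` are the distances of the terminals
from those of its children above which the two paths meet. -/
theorem IsBinary.exists_fork (hB : IsBinary S a b rank R) {u w : V} (hu : u ∈ R) (hw : w ∈ R)
    (huw : u ≠ w) : ∃ p q : ℕ, up^[p + 1] (some (u, 0)) = up^[q + 1] (some (w, 0)) ∧
      ¬ IsAncestor S a b rank (up^[p] (some (u, 0))) (some (w, 0)) ∧
      ¬ IsAncestor S a b rank (up^[q] (some (w, 0))) (some (u, 0)) := by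
  have hex : ∃ p, IsAncestor S a b rank (up^[p] (some (u, 0))) (some (w, 0)) := by
    obtain ⟨p, hp⟩ := hB.isAncestor_none (some (u, 0))
    exact ⟨p, by rw [hp]; exact hB.isAncestor_none _⟩
  obtain ⟨p, hp⟩ : ∃ p, Nat.find hex = p + 1 := by
    refine Nat.exists_eq_succ_of_ne_zero fun h0 => ?_
    have := Nat.find_spec hex
    rw [h0] at this
    obtain ⟨q, hq⟩ := this
    cases q with
    | zero =>
      simp only [Function.iterate_zero, id, Option.some.injEq, Prod.mk.injEq, and_true] at hq
      exact huw hq.symm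
    | succ q => exact hB.leaf_iterate_ne hu q hq
  have hanc := Nat.find_spec hex
  have hmin : ∀ j, j < p + 1 → ¬ IsAncestor S a b rank (up^[j] (some (u, 0))) (some (w, 0)) :=
    fun j hj => Nat.find_min hex (by omega)
  rw [hp] at hanc
  have hex2 : ∃ q, up^[q] (some (w, 0)) = up^[p + 1] (some (u, 0)) := hanc
  obtain ⟨q, hq⟩ : ∃ q, Nat.find hex2 = q + 1 := by
    refine Nat.exists_eq_succ_of_ne_zero fun h0 => ?_
    have := Nat.find_spec hex2
    rw [h0] at this
    exact hB.leaf_iterate_ne hw p this.symm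
  have hq2 := Nat.find_spec hex2
  have hqmin := Nat.find_min hex2 (m := q) (by omega)
  rw [hq] at hq2
  refine ⟨p, q, hq2.symm, hmin p (by omega), ?_⟩
  rintro ⟨j, hj⟩
  have hne : up^[q] (some (w, 0)) ≠ none := by
    intro h0
    rw [Function.iterate_succ_apply', h0] at hq2
    exact hqmin (h0.trans hq2)
  have hjp : p + 1 ≤ j := by
    by_contra hlt
    exact hmin j (by omega) (by rw [hj]; exact ⟨q, rfl⟩)
  have h1 := hB.level_ancestor_le (isAncestor_iterate (S := S) (a := a) (b := b) (rank := rank)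
    hjp (some (u, 0)))
  have h2 := hB.level_lt _ hne
  rw [← Function.iterate_succ_apply' (f := up), hq2] at h2
  rw [hj] at h1
  omega

theorem IsBinary.mem_pathEdges (hB : IsBinary S a b rank R) {u w : V} {p q : ℕ}
    (h : up^[p + 1] (some (u, 0)) = up^[q + 1] (some (w, 0)))
    (hp : ¬ IsAncestor S a b rank (up^[p] (some (u, 0))) (some (w, 0)))
    (hq : ¬ IsAncestor S a b rank (up^[q] (some (w, 0))) (some (u, 0))) (m : Node V) :
    m ∈ pathEdges S a b rank u w ↔
      (∃ j ≤ p, m = up^[j] (some (u, 0))) ∨ ∃ j ≤ q, m = up^[j] (some (w, 0)) := by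
  have key : ∀ {u w : V} {p q : ℕ}, up^[p + 1] (some (u, 0)) = up^[q + 1] (some (w, 0)) →
      ¬ IsAncestor S a b rank (up^[p] (some (u, 0))) (some (w, 0)) →
      ((IsAncestor S a b rank m (some (u, 0)) ∧ ¬ IsAncestor S a b rank m (some (w, 0))) ↔
        ∃ j ≤ p, m = up^[j] (some (u, 0))) := by
    intro u w p q h hp
    constructor
    · rintro ⟨⟨j, rfl⟩, hw⟩
      refine ⟨j, ?_, rfl⟩
      by_contra hj
      refine hw ((isAncestor_iterate (show p + 1 ≤ j by omega) _).trans ?_)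
      rw [h]
      exact ⟨_, rfl⟩
    · rintro ⟨j, hj, rfl⟩
      exact ⟨⟨j, rfl⟩, fun hw => hp ((isAncestor_iterate hj _).trans hw)⟩
  rw [← key h hp, ← key h.symm hq, pathEdges, Finset.mem_filter, Xor]
  constructor
  · exact fun h => h.2.2
  · intro hx
    refine ⟨?_, ?_, hx⟩
    · rcases hx with ⟨⟨j, rfl⟩, -⟩ | ⟨⟨j, rfl⟩, -⟩ <;> exact hB.iterate_mem (zero_mem_nodes _) j
    · rintro rfl
      rcases hx with ⟨-, hx⟩ | ⟨-, hx⟩ <;> exact hx (hB.isAncestor_none _)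

end Paths

/-! ### Marked edges and the witness tree -/

section Markings

variable {V : Type*} [Fintype V] {S : SimpleGraph V} {a b : V} {rank : V → V → ℕ}
  {R : Finset V} {μ : Marking S a b rank}

local notation "up" => nodeParent S a b rank

theorem isMarked_iff {m : Node V} : IsMarked μ m ↔
    ∃ h : up m ∈ nodes S a b ∧ #(nodeChildren S a b rank (up m)) = 2, (μ ⟨up m, h⟩).1 = m := by
  constructor
  · rintro ⟨⟨n, hn⟩, rfl⟩
    have h := (mem_nodeChildren.1 (μ ⟨n, hn⟩).2).2.2
    have key : ∀ n', (hn' : n' ∈ nodes S a b ∧ #(nodeChildren S a b rank n') = 2) → n = n' →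
        (μ ⟨n', hn'⟩).1 = (μ ⟨n, hn⟩).1 := by
      rintro n' hn' rfl; rfl
    exact ⟨by rw [h]; exact hn, key _ _ h.symm⟩
  · rintro ⟨h, hm⟩
    exact ⟨_, hm⟩

theorem IsMarked.mem_nodeChildren {m : Node V} (h : IsMarked μ m) :
    m ∈ nodeChildren S a b rank (up m) := by
  obtain ⟨h, hm⟩ := isMarked_iff.1 h
  have := (μ ⟨up m, h⟩).2
  rwa [hm] at this

theorem not_isMarked_none : ¬ IsMarked μ none := fun h =>
  (mem_nodeChildren.1 h.mem_nodeChildren).2.1 rfl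

theorem IsMarked.eq {g g' : Node V} (h : IsMarked μ g) (h' : IsMarked μ g')
    (hp : up g = up g') : g = g' := by
  obtain ⟨h, hm⟩ := isMarked_iff.1 h
  obtain ⟨h', hm'⟩ := isMarked_iff.1 h'
  rw [← hm, ← hm']
  have key : ∀ n n', (hn : n ∈ nodes S a b ∧ #(nodeChildren S a b rank n) = 2) →
      (hn' : n' ∈ nodes S a b ∧ #(nodeChildren S a b rank n') = 2) → n = n' →
      (μ ⟨n, hn⟩).1 = (μ ⟨n', hn'⟩).1 := by
    rintro n n' hn hn' rfl; rfl
  exact key _ _ h h' hp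

theorem isMarked_or {n m m' : Node V} (hn : n ∈ nodes S a b)
    (h2 : #(nodeChildren S a b rank n) = 2) (hm : m ∈ nodeChildren S a b rank n)
    (hm' : m' ∈ nodeChildren S a b rank n) (hne : m ≠ m') : IsMarked μ m ∨ IsMarked μ m' := by
  have hsub : {m, m'} ⊆ nodeChildren S a b rank n := by
    intro x hx
    simp only [Finset.mem_insert, Finset.mem_singleton] at hx
    rcases hx with rfl | rfl <;> assumption
  have heq := Finset.eq_of_subset_of_card_le hsub (by rw [h2, Finset.card_pair hne])
  have h := (μ ⟨n, hn, h2⟩).2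
  simp only [← heq, Finset.mem_insert, Finset.mem_singleton] at h
  rcases h with h | h
  · exact Or.inl ⟨_, h⟩
  · exact Or.inr ⟨_, h⟩

theorem IsBinary.isMarked_or (hB : IsBinary S a b rank R) {n m m' : Node V}
    (hn : n ∈ nodes S a b) (hm : m ∈ nodeChildren S a b rank n)
    (hm' : m' ∈ nodeChildren S a b rank n) (hne : m ≠ m') : IsMarked μ m ∨ IsMarked μ m' :=
  MinPower.isMarked_or hn
    (le_antisymm (hB.card_le n hn) (Finset.one_lt_card.2 ⟨m, hm, m', hm', hne⟩)) hm hm' hne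

theorem exists_not_isMarked (μ : Marking S a b rank) {n : Node V}
    (hne : nodeChildren S a b rank n ≠ ∅) : ∃ m ∈ nodeChildren S a b rank n, ¬ IsMarked μ m := by
  obtain ⟨m, hm⟩ := Finset.nonempty_iff_ne_empty.2 hne
  by_cases h : IsMarked μ m
  · obtain ⟨⟨-, h2⟩, -⟩ := isMarked_iff.1 h
    rw [(mem_nodeChildren.1 hm).2.2] at h2
    obtain ⟨m', hm', hne⟩ := Finset.exists_mem_ne (by omega : 1 < #(nodeChildren S a b rank n)) m
    refine ⟨m', hm', fun h' => hne (h'.eq h ?_)⟩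
    rw [(mem_nodeChildren.1 hm).2.2, (mem_nodeChildren.1 hm').2.2]
  · exact ⟨m, hm, h⟩

/-- The unmarked path that descends from the node `n` ends at the terminal `u`. -/
def Descends (μ : Marking S a b rank) (n : Node V) (u : V) : Prop :=
  ∃ k, up^[k] (some (u, 0)) = n ∧ ∀ l < k, ¬ IsMarked μ (up^[l] (some (u, 0)))

theorem Descends.up {n : Node V} {u : V} (h : Descends μ n u) (hn : ¬ IsMarked μ n) :
    Descends μ (up n) u := by
  obtain ⟨k, rfl, hk⟩ := h
  refine ⟨k + 1, Function.iterate_succ_apply' _ _ _, fun l hl => ?_⟩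
  rcases Nat.lt_succ_iff_lt_or_eq.1 hl with h | rfl
  exacts [hk l h, hn]

/-- As at most one edge below a node is marked, and none if there is only one, an unmarked path can
always be continued until it reaches a terminal. -/
theorem IsBinary.exists_descends (hB : IsBinary S a b rank R) (μ : Marking S a b rank)
    {n : Node V} (hn : n ∈ nodes S a b) : ∃ u ∈ R, Descends μ n u := by
  induction h : (nodes S a b).sup (level S a b) - level S a b n using Nat.strong_induction_on
    generalizing n with
  | _ d ih =>
    subst h
    by_cases hc : nodeChildren S a b rank n = ∅
    · obtain ⟨u, hu, rfl⟩ := (hB.leaf n hn).1 hc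
      exact ⟨u, hu, 0, rfl, by simp⟩
    · obtain ⟨m, hm, hmm⟩ := exists_not_isMarked μ hc
      obtain ⟨hmn, hm0, hmp⟩ := mem_nodeChildren.1 hm
      have h1 := hB.level_lt m hm0
      have h2 := Finset.le_sup (f := level S a b) hmn
      rw [hmp] at h1
      obtain ⟨u, hu, hd⟩ := ih _ (by omega) hmn rfl
      exact ⟨u, hu, hmp ▸ hd.up hmm⟩

theorem IsBinary.fork_isMarked (hB : IsBinary S a b rank R) {u w : V} {p q : ℕ}
    (h : up^[p + 1] (some (u, 0)) = up^[q + 1] (some (w, 0)))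
    (hp : ¬ IsAncestor S a b rank (up^[p] (some (u, 0))) (some (w, 0)))
    (hq : ¬ IsAncestor S a b rank (up^[q] (some (w, 0))) (some (u, 0))) :
    (IsMarked μ (up^[p] (some (u, 0))) ∧ ¬ IsMarked μ (up^[q] (some (w, 0)))) ∨
      (¬ IsMarked μ (up^[p] (some (u, 0))) ∧ IsMarked μ (up^[q] (some (w, 0)))) := by
  have hne : up^[p] (some (u, 0)) ≠ up^[q] (some (w, 0)) := fun h0 => hp (h0 ▸ ⟨q, rfl⟩)
  rw [Function.iterate_succ_apply', Function.iterate_succ_apply'] at h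
  have h1 : up^[p] (some (u, 0)) ∈ nodeChildren S a b rank (up (up^[p] (some (u, 0)))) :=
    mem_nodeChildren.2 ⟨hB.iterate_mem (zero_mem_nodes u) p,
      fun h0 => hp (h0 ▸ hB.isAncestor_none _), rfl⟩
  have h2 : up^[q] (some (w, 0)) ∈ nodeChildren S a b rank (up (up^[p] (some (u, 0)))) :=
    mem_nodeChildren.2 ⟨hB.iterate_mem (zero_mem_nodes w) q,
      fun h0 => hq (h0 ▸ hB.isAncestor_none _), h.symm⟩
  have hor := hB.isMarked_or (μ := μ) (hB.parent_mem _ (hB.iterate_mem (zero_mem_nodes u) p))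
    h1 h2 hne
  have hnot : ¬ (IsMarked μ (up^[p] (some (u, 0))) ∧ IsMarked μ (up^[q] (some (w, 0)))) :=
    fun h' => hne (h'.1.eq h'.2 h)
  tauto

/-- At the lowest common ancestor of two terminals one of the two paths uses a marked edge. -/
theorem IsBinary.descends_unique (hB : IsBinary S a b rank R) {n : Node V} {u w : V}
    (hu : u ∈ R) (hw : w ∈ R) (h : Descends μ n u) (h' : Descends μ n w) : u = w := by
  by_contra huw
  obtain ⟨p, q, hpq, hp, hq⟩ := hB.exists_fork hu hw huw
  obtain ⟨k, rfl, hk⟩ := h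
  obtain ⟨l, hkl, hl⟩ := h'
  have h1 : p < k := by
    by_contra hlt
    exact hp ((isAncestor_iterate (by omega : k ≤ p) _).trans (hkl ▸ ⟨l, rfl⟩))
  have h2 : q < l := by
    by_contra hlt
    exact hq ((isAncestor_iterate (by omega : l ≤ q) _).trans (hkl ▸ ⟨k, rfl⟩))
  rcases hB.fork_isMarked (μ := μ) hpq hp hq with h | h
  · exact hk p h1 h.1
  · exact hl q h2 h.2

/-- The ends `u` and `w` of an edge of the witness tree, the only marked edge of the path between
them being the one above `up^[p] u`, just below the lowest common ancestor of `u` and `w`. -/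
structure IsWitness (μ : Marking S a b rank) (u w : V) (p q : ℕ) : Prop where
  eq : up^[p + 1] (some (u, 0)) = up^[q + 1] (some (w, 0))
  marked : IsMarked μ (up^[p] (some (u, 0)))
  left : ∀ j < p, ¬ IsMarked μ (up^[j] (some (u, 0)))
  right : ∀ j < q + 1, ¬ IsMarked μ (up^[j] (some (w, 0)))
  path : ∀ m, m ∈ pathEdges S a b rank u w ↔
    (∃ j ≤ p, m = up^[j] (some (u, 0))) ∨ ∃ j ≤ q, m = up^[j] (some (w, 0))

theorem IsBinary.isWitness_of_fork (hB : IsBinary S a b rank R) {u w : V} {p q : ℕ}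
    (h1 : #{m ∈ pathEdges S a b rank u w | IsMarked μ m} = 1)
    (h : up^[p + 1] (some (u, 0)) = up^[q + 1] (some (w, 0)))
    (hp : ¬ IsAncestor S a b rank (up^[p] (some (u, 0))) (some (w, 0)))
    (hq : ¬ IsAncestor S a b rank (up^[q] (some (w, 0))) (some (u, 0)))
    (hm : IsMarked μ (up^[p] (some (u, 0)))) : IsWitness μ u w p q := by
  have hpath := hB.mem_pathEdges h hp hq
  have huniq : ∀ m ∈ pathEdges S a b rank u w, IsMarked μ m → m = up^[p] (some (u, 0)) := by
    intro m hm1 hm2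
    refine Finset.card_le_one.1 h1.le _ (Finset.mem_filter.2 ⟨hm1, hm2⟩) _
      (Finset.mem_filter.2 ⟨(hpath _).2 (Or.inl ⟨p, le_refl _, rfl⟩), hm⟩)
  refine ⟨h, hm, fun j hj hmj => ?_, fun j hj hmj => ?_, hpath⟩
  · have heq := huniq _ ((hpath _).2 (Or.inl ⟨j, hj.le, rfl⟩)) hmj
    have hne : up^[j] (some (u, 0)) ≠ none := fun h0 => not_isMarked_none (h0 ▸ hmj)
    have := hB.level_iterate_succ_lt hne (p - j - 1)
    rw [← Function.iterate_add_apply, show p - j - 1 + 1 + j = p by omega, ← heq] at this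
    omega
  · have heq := huniq _ ((hpath _).2 (Or.inr ⟨j, by omega, rfl⟩)) hmj
    exact hp ⟨j, heq⟩

theorem IsBinary.exists_isWitness (hB : IsBinary S a b rank R) {u w : V} (hu : u ∈ R)
    (hw : w ∈ R) (huw : u ≠ w) (h1 : #{m ∈ pathEdges S a b rank u w | IsMarked μ m} = 1) :
    (∃ p q, IsWitness μ u w p q) ∨ ∃ p q, IsWitness μ w u p q := by
  obtain ⟨p, q, h, hp, hq⟩ := hB.exists_fork hu hw huw
  rcases hB.fork_isMarked (μ := μ) h hp hq with hm | hm
  · exact Or.inl ⟨p, q, hB.isWitness_of_fork h1 h hp hq hm.1⟩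
  · rw [pathEdges_comm] at h1
    exact Or.inr ⟨q, p, hB.isWitness_of_fork h1 h.symm hq hp hm.2⟩

/-- The marked edges of the binary tree whose witness edges have a path through the edge above
`m`: the parent of such a `g` is a proper ancestor of `m`, and all the edges between `m` and that
ancestor, except possibly the topmost one, are unmarked.  As the root is its own parent, `k` may
exceed the number of these edges; this only happens when the root is reached anyway. -/
def chain (μ : Marking S a b rank) (m : Node V) : Finset (Node V) :=
  (nodes S a b).filter fun g => IsMarked μ g ∧
    ∃ k, up^[k + 1] m = up g ∧ ∀ l < k, ¬ IsMarked μ (up^[l] m)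

/-- The end of the unmarked path that descends from `n` (the value `a` is never used, since every
node of the binary tree has such a path). -/
def leafOf (R : Finset V) (μ : Marking S a b rank) (n : Node V) : V :=
  if h : ∃ u ∈ R, Descends μ n u then h.choose else a

theorem IsBinary.leafOf_eq (hB : IsBinary S a b rank R) {n : Node V} {u : V} (hu : u ∈ R)
    (h : Descends μ n u) : leafOf R μ n = u := by
  have hex : ∃ u ∈ R, Descends μ n u := ⟨u, hu, h⟩
  rw [leafOf, dif_pos hex]
  exact hB.descends_unique hex.choose_spec.1 hu hex.choose_spec.2 h

/-- The edge of the witness tree that corresponds to the marked edge above `g`. -/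
def witnessOf (R : Finset V) (μ : Marking S a b rank) (g : Node V) : Sym2 V :=
  s(leafOf R μ g, leafOf R μ (up g))

theorem IsBinary.exists_mem_chain (hB : IsBinary S a b rank R) {u w : V} {p q : ℕ}
    (hu : u ∈ R) (hw : w ∈ R) (h : IsWitness μ u w p q) {m : Node V}
    (hm : m ∈ pathEdges S a b rank u w) : ∃ g ∈ chain μ m, witnessOf R μ g = s(u, w) := by
  refine ⟨up^[p] (some (u, 0)), ?_, ?_⟩
  · refine Finset.mem_filter.2 ⟨hB.iterate_mem (zero_mem_nodes u) p, h.marked, ?_⟩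
    rw [← Function.iterate_succ_apply' (f := up)]
    rcases (h.path m).1 hm with ⟨j, hj, rfl⟩ | ⟨j, hj, rfl⟩
    · refine ⟨p - j, ?_, fun l hl => ?_⟩
      · rw [← Function.iterate_add_apply]; congr 2; omega
      · rw [← Function.iterate_add_apply]; exact h.left _ (by omega)
    · refine ⟨q - j, ?_, fun l hl => ?_⟩
      · rw [h.eq, ← Function.iterate_add_apply]
        exact congrArg (fun k => up^[k] (some (w, 0))) (by omega)
      · rw [← Function.iterate_add_apply]; exact h.right _ (by omega)
  · rw [witnessOf, hB.leafOf_eq hu ⟨p, rfl, h.left⟩,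
      hB.leafOf_eq (n := up (up^[p] (some (u, 0)))) hw ⟨q + 1, ?_, h.right⟩]
    rw [← Function.iterate_succ_apply' (f := up)]
    exact h.eq.symm

theorem IsBinary.witnessSet_subset (hB : IsBinary S a b rank R) {f e : Sym2 V}
    (he : e ∈ witnessSet R μ f) : ∃ v, originalEdge S a b v = f ∧
      ∃ g ∈ chain μ (some (v, 0)), witnessOf R μ g = e := by
  obtain ⟨he1, u, w, rfl, v, hv, hpath⟩ := Finset.mem_filter.1 he
  refine ⟨v, hv, ?_⟩
  obtain ⟨-, u', w', heq, hu', hw', hne, h1⟩ := Finset.mem_filter.1 he1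
  have hpath' : some (v, 0) ∈ pathEdges S a b rank u' w' := by
    rcases Sym2.eq_iff.1 heq with ⟨rfl, rfl⟩ | ⟨rfl, rfl⟩
    · exact hpath
    · rwa [pathEdges_comm]
  rw [heq]
  rcases hB.exists_isWitness hu' hw' hne h1 with ⟨p, q, h⟩ | ⟨p, q, h⟩
  · exact hB.exists_mem_chain hu' hw' h hpath'
  · rw [Sym2.eq_swap]
    rw [pathEdges_comm] at hpath'
    exact hB.exists_mem_chain hw' hu' h hpath'

/-- The marked edge above `m` gives the witness edge between the ends of the unmarked paths that
descend from `m` and from its parent. -/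
theorem IsBinary.mem_witnessTree (hB : IsBinary S a b rank R) {m : Node V} (hm : IsMarked μ m)
    {u w : V} (hu : u ∈ R) (hw : w ∈ R) (hum : Descends μ m u) (hwm : Descends μ (up m) w) :
    s(u, w) ∈ witnessTree R μ := by
  obtain ⟨p, rfl, hp⟩ := hum
  obtain ⟨k, hk, hk'⟩ := hwm
  obtain ⟨hmn, hm0, -⟩ := mem_nodeChildren.1 hm.mem_nodeChildren
  obtain ⟨q, rfl⟩ : ∃ q, k = q + 1 := by
    refine Nat.exists_eq_succ_of_ne_zero ?_
    rintro rfl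
    rw [← Function.iterate_succ_apply' (f := up)] at hk
    exact hB.leaf_iterate_ne hw p hk.symm
  have hnotanc : ¬ IsAncestor S a b rank (up^[p] (some (u, 0))) (some (w, 0)) := by
    rintro ⟨j, hj⟩
    by_cases hjq : j < q + 1
    · exact hk' j hjq (hj ▸ hm)
    · have h1 := hB.level_ancestor_le (isAncestor_iterate (S := S) (a := a) (b := b)
        (rank := rank) (by omega : q + 1 ≤ j) (some (w, 0)))
      have h2 := hB.level_lt _ hm0
      rw [hj, hk] at h1
      omega
  have huw : u ≠ w := by
    rintro rfl
    exact hnotanc ⟨p, rfl⟩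
  obtain ⟨p', q', hpq, hp', hq'⟩ := hB.exists_fork hu hw huw
  rw [← Function.iterate_succ_apply' (f := up)] at hk
  have h1 : p' = p := by
    rcases lt_trichotomy p' p with h | h | h
    · refine absurd ((isAncestor_iterate (show p' + 1 ≤ p from h) _).trans ?_) hnotanc
      rw [hpq]
      exact ⟨_, rfl⟩
    · exact h
    · refine absurd ((isAncestor_iterate (show p + 1 ≤ p' from h) _).trans ?_) hp'
      rw [← hk]
      exact ⟨_, rfl⟩
  subst h1
  have h2 : q' < q + 1 := by
    by_contra h
    refine hq' ((isAncestor_iterate (by omega : q + 1 ≤ q') _).trans ?_)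
    rw [hk]
    exact ⟨_, rfl⟩
  refine Finset.mem_filter.2 ⟨Finset.mem_univ _, u, w, rfl, hu, hw, huw,
    Finset.card_eq_one.2 ⟨up^[p'] (some (u, 0)), ?_⟩⟩
  ext m
  rw [Finset.mem_filter, hB.mem_pathEdges hpq hp' hq', Finset.mem_singleton]
  constructor
  · rintro ⟨⟨j, hj, rfl⟩ | ⟨j, hj, rfl⟩, hmj⟩
    · rcases hj.lt_or_eq with h | rfl
      exacts [absurd hmj (hp j h), rfl]
    · exact absurd hmj (hk' j (by omega))
  · rintro rfl
    exact ⟨Or.inl ⟨p', le_refl _, rfl⟩, hm⟩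

/-- The witness tree connects the terminals: by induction on `k`, it connects a terminal to the
end of the unmarked path that descends from the `k`-th ancestor of the terminal. -/
theorem IsBinary.connects_witnessTree (hB : IsBinary S a b rank R) (μ : Marking S a b rank) :
    State.Connects R (witnessTree R μ, []) := by
  have key : ∀ k, ∀ u ∈ R, ∀ t ∈ R, Descends μ (up^[k] (some (u, 0))) t →
      Linked (witnessTree R μ) [] u t := by
    intro k u hu
    induction k with
    | zero =>
      intro t ht h
      rw [hB.descends_unique hu ht ⟨0, rfl, by simp⟩ h]
    | succ k ih =>
      intro t ht h
      rw [Function.iterate_succ_apply'] at h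
      obtain ⟨s, hs, hd⟩ := hB.exists_descends μ (hB.iterate_mem (zero_mem_nodes u) k)
      refine (ih s hs hd).trans ?_
      by_cases hm : IsMarked μ (up^[k] (some (u, 0)))
      · exact linked_of_mem (hB.mem_witnessTree hm hs ht hd h)
      · rw [hB.descends_unique hs ht (hd.up hm) h]
  obtain ⟨t, ht, hd⟩ := hB.exists_descends μ none_mem_nodes
  have hall : ∀ u ∈ R, Linked (witnessTree R μ) [] u t := by
    intro u hu
    obtain ⟨k, hk⟩ := hB.isAncestor_none (some (u, 0))
    exact key k u hu t ht (hk ▸ hd)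
  exact fun u hu w hw => (hall u hu).trans (hall w hw).symm

theorem IsBinary.good_witnessTree (hB : IsBinary S a b rank R) (μ : Marking S a b rank) :
    State.Good R (witnessTree R μ, []) := by
  refine ⟨hB.connects_witnessTree μ, fun e he => ?_⟩
  obtain ⟨-, u, w, rfl, hu, hw, huw, -⟩ := Finset.mem_filter.1 he
  refine ⟨by rwa [Sym2.mk_isDiag_iff], fun v hv => ?_⟩
  rcases Sym2.mem_iff.1 hv with rfl | rfl <;> assumption

end Markings

/-! ### The series in the bound -/

section Series

/-- The expected value of `H_{q + i}` for a geometric random variable `q ≥ 1` with parameter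
`1 / 2`. -/
def geomHarmonic (i : ℕ) : ℝ := ∑' q : ℕ, 1 / 2 ^ (q + 1) * (harmonic (q + 1 + i) : ℝ)

theorem harmonic_cast_succ (n : ℕ) : (harmonic (n + 1) : ℝ) = harmonic n + 1 / (n + 1) := by
  rw [harmonic_succ]; push_cast; rw [one_div]

theorem harmonic_cast_le (n : ℕ) : (harmonic n : ℝ) ≤ n := by
  induction n with
  | zero => simp
  | succ n ih =>
    rw [harmonic_cast_succ]
    have : (1 : ℝ) / (n + 1) ≤ 1 := by
      rw [div_le_one (by positivity)]; linarith [Nat.cast_nonneg (α := ℝ) n]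
    push_cast
    linarith

theorem summable_geomHarmonic (i : ℕ) :
    Summable fun q : ℕ => 1 / 2 ^ (q + 1) * (harmonic (q + 1 + i) : ℝ) := by
  have h1 : Summable fun q : ℕ => (q : ℝ) ^ 1 * (1 / 2 : ℝ) ^ q :=
    summable_pow_mul_geometric_of_norm_lt_one 1 (by norm_num)
  have h2 : Summable fun q : ℕ => (1 / 2 : ℝ) ^ q :=
    summable_geometric_of_lt_one (by norm_num) (by norm_num)
  refine Summable.of_nonneg_of_le
    (fun q => mul_nonneg (by positivity) (harmonic_cast_nonneg _)) (fun q => ?_)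
    (h1.add (h2.mul_left (1 + i : ℝ)))
  have h3 := harmonic_cast_le (q + 1 + i)
  have h4 : (1 : ℝ) / 2 ^ (q + 1) ≤ (1 / 2) ^ q := by
    rw [div_pow, one_pow]
    exact one_div_le_one_div_of_le (by positivity) (pow_le_pow_right₀ (by norm_num) (by omega))
  calc 1 / 2 ^ (q + 1) * (harmonic (q + 1 + i) : ℝ) ≤ (1 / 2) ^ q * ((q + 1 + i : ℕ) : ℝ) :=
        mul_le_mul h4 h3 (harmonic_cast_nonneg _) (by positivity)
    _ = _ := by push_cast; ring

theorem geomHarmonic_eq (i : ℕ) :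
    geomHarmonic i = 1 / 2 * harmonic (i + 1) + 1 / 2 * geomHarmonic (i + 1) := by
  rw [geomHarmonic, (summable_geomHarmonic i).tsum_eq_zero_add, geomHarmonic, ← tsum_mul_left]
  congr 1
  · norm_num [add_comm]
  · refine tsum_congr fun q => ?_
    rw [show q + 1 + 1 + i = q + 1 + (i + 1) by omega]
    ring

theorem harmonic_le_geomHarmonic (i : ℕ) : (harmonic (i + 1) : ℝ) ≤ geomHarmonic i := by
  have h : HasSum (fun q : ℕ => (1 : ℝ) / 2 ^ (q + 1)) 1 := by
    have h := hasSum_geometric_two' (1 : ℝ)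
    simpa only [div_div, ← pow_succ'] using h
  refine (le_of_eq ?_).trans ((h.mul_right (harmonic (i + 1) : ℝ)).summable.tsum_le_tsum ?_
    (summable_geomHarmonic i))
  · rw [(h.mul_right _).tsum_eq, one_mul]
  · intro q
    exact mul_le_mul_of_nonneg_left (harmonic_cast_mono (by omega)) (by positivity)

theorem geomHarmonic_zero : geomHarmonic 0 = Real.log 4 := by
  have hlog : HasSum (fun q : ℕ => (1 / 2 : ℝ) ^ (q + 1) / (q + 1)) (Real.log 2) := by
    have := Real.hasSum_pow_div_log_of_abs_lt_one (x := (1 / 2 : ℝ)) (by norm_num [abs_of_pos])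
    rwa [show (1 : ℝ) - 1 / 2 = 2⁻¹ by norm_num, Real.log_inv, neg_neg] at this
  have hs := summable_geomHarmonic 0
  simp only [add_zero] at hs
  have hs' : Summable fun q : ℕ => (1 : ℝ) / 2 ^ q * harmonic q :=
    (summable_nat_add_iff (f := fun q : ℕ => (1 : ℝ) / 2 ^ q * harmonic q) 1).1 hs
  have h0 : geomHarmonic 0 = ∑' q : ℕ, (1 : ℝ) / 2 ^ q * harmonic q := by
    rw [hs'.tsum_eq_zero_add]
    simp [geomHarmonic]
  have h1 : geomHarmonic 0 = 1 / 2 * geomHarmonic 0 + Real.log 2 := by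
    conv_rhs => rw [h0, ← tsum_mul_left, ← hlog.tsum_eq,
      ← (hs'.mul_left (1 / 2)).tsum_add hlog.summable]
    refine tsum_congr fun q => ?_
    rw [add_zero, harmonic_cast_succ, div_pow, one_pow]
    ring
  have h2 : Real.log 4 = 2 * Real.log 2 := by
    rw [show (4 : ℝ) = 2 ^ 2 by norm_num, Real.log_pow]; norm_num
  linarith

theorem bound_eq (M : ℝ) (i : ℕ) :
    bound M i = M * (1 / 2 ^ i * harmonic i + (1 - 1 / 2 ^ i) * geomHarmonic i) := by
  have : ∑' q : ℕ, 1 / 2 ^ (q + 1) * (M * (harmonic (q + 1 + i) : ℝ)) = M * geomHarmonic i := by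
    rw [geomHarmonic, ← tsum_mul_left]
    exact tsum_congr fun q => by ring
  rw [bound, this]
  ring

theorem bound_two {M : ℝ} (hM : 0 < M) : bound M 2 / M = 3 * Real.log 4 - 9 / 4 := by
  rw [bound_eq, mul_div_cancel_left₀ _ hM.ne']
  have h0 := geomHarmonic_eq 0
  have h1 := geomHarmonic_eq 1
  rw [geomHarmonic_zero] at h0
  norm_num at h0 h1 ⊢
  linarith

theorem geomHarmonic_pred_le {i : ℕ} (hi : 1 ≤ i) : geomHarmonic (i - 1) ≤
    1 / 2 ^ i * harmonic i + (1 - 1 / 2 ^ i) * geomHarmonic i := by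
  obtain ⟨i, rfl⟩ : ∃ j, i = j + 1 := ⟨i - 1, by omega⟩
  rw [Nat.add_sub_cancel, geomHarmonic_eq i]
  have h1 : (1 : ℝ) / 2 ^ (i + 1) ≤ 1 / 2 := by
    refine one_div_le_one_div_of_le (by norm_num) ?_
    calc (2 : ℝ) = 2 ^ 1 := by norm_num
      _ ≤ 2 ^ (i + 1) := pow_le_pow_right₀ (by norm_num) (by omega)
  have h2 := harmonic_le_geomHarmonic (i + 1)
  have h3 : (harmonic (i + 1) : ℝ) ≤ harmonic (i + 1 + 1) := harmonic_cast_mono (by omega)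
  nlinarith

end Series

/-! ### Exchanging the choice at one node -/

section Flip

variable {V : Type*} [Fintype V] {S : SimpleGraph V} {a b : V} {rank : V → V → ℕ}

local notation "up" => nodeParent S a b rank

/-- Exchanging the choice made at a node with two children is an involution of the markings. -/
theorem exists_flip {n m : Node V} (hn : n ∈ nodes S a b)
    (h2 : #(nodeChildren S a b rank n) = 2) (hm : m ∈ nodeChildren S a b rank n) :
    ∃ F : Marking S a b rank → Marking S a b rank, Function.Involutive F ∧
      (∀ μ, IsMarked (F μ) m ↔ ¬ IsMarked μ m) ∧
      ∀ μ g, up g ≠ n → (IsMarked (F μ) g ↔ IsMarked μ g) := by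
  obtain ⟨m', hm', hne⟩ := Finset.exists_mem_ne (by omega : 1 < #(nodeChildren S a b rank n)) m
  let x : {m : Node V // m ∈ nodeChildren S a b rank n} := ⟨m, hm⟩
  let x' : {m : Node V // m ∈ nodeChildren S a b rank n} := ⟨m', hm'⟩
  have hxx : x' ≠ x := fun h => hne (congrArg Subtype.val h)
  let N : {n : Node V // n ∈ nodes S a b ∧ #(nodeChildren S a b rank n) = 2} := ⟨n, hn, h2⟩
  let F : Marking S a b rank → Marking S a b rank := fun μ =>
    Function.update μ N (Equiv.swap x x' (μ N))
  have hup : up m = n := (mem_nodeChildren.1 hm).2.2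
  have hiff : ∀ μ : Marking S a b rank, IsMarked μ m ↔ μ N = x := by
    intro μ
    constructor
    · intro h
      obtain ⟨h, hm⟩ := isMarked_iff.1 h
      have key : ∀ n', (hn' : n' ∈ nodes S a b ∧ #(nodeChildren S a b rank n') = 2) →
          n' = n → (μ ⟨n', hn'⟩).1 = (μ N).1 := by
        rintro n' hn' rfl; rfl
      exact Subtype.ext ((key _ h hup).symm.trans hm)
    · intro h
      exact ⟨N, by rw [h]⟩
  have hor : ∀ μ : Marking S a b rank, μ N = x ∨ μ N = x' := by
    intro μ
    rcases isMarked_or (μ := μ) hn h2 hm hm' hne.symm with h | h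
    · exact Or.inl ((hiff μ).1 h)
    · by_contra hcon
      push Not at hcon
      obtain ⟨k, hk⟩ := h
      have hk' : k.1 = n := by
        rw [← (mem_nodeChildren.1 (μ k).2).2.2, hk, (mem_nodeChildren.1 hm').2.2]
      obtain rfl : k = N := Subtype.ext hk'
      exact hcon.2 (Subtype.ext hk)
  refine ⟨F, fun μ => ?_, fun μ => ?_, fun μ g hg => ?_⟩
  · simp [F]
  · rw [hiff, hiff]
    simp only [F, Function.update_self]
    rcases hor μ with h | h
    · rw [h, Equiv.swap_apply_left]; simp [hxx]
    · rw [h, Equiv.swap_apply_right]; simp [hxx]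
  · constructor
    · rintro ⟨k, hk⟩
      have hk' : k ≠ N := by
        rintro rfl
        exact hg (hk ▸ (mem_nodeChildren.1 (F μ N).2).2.2)
      exact ⟨k, by rw [← hk]; simp only [F, Function.update_of_ne hk']⟩
    · rintro ⟨k, hk⟩
      have hk' : k ≠ N := by
        rintro rfl
        exact hg (hk ▸ (mem_nodeChildren.1 (μ N).2).2.2)
      exact ⟨k, by rw [← hk]; simp only [F, Function.update_of_ne hk']⟩

theorem two_mul_sum_eq {α : Type*} [Fintype α] {F : α → α} (hF : Function.Involutive F)
    (f : α → ℝ) : 2 * ∑ x, f x = ∑ x, (f x + f (F x)) := by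
  rw [Finset.sum_add_distrib, two_mul]
  congr 1
  exact (Fintype.sum_bijective F hF.bijective _ _ fun x => rfl).symm

end Flip

/-! ### The chain of witnesses above a node -/

section Chain

variable {V : Type*} [Fintype V] {S : SimpleGraph V} {a b : V} {rank : V → V → ℕ}
  {R : Finset V} {μ : Marking S a b rank}

local notation "up" => nodeParent S a b rank

theorem mem_chain {m g : Node V} : g ∈ chain μ m ↔
    IsMarked μ g ∧ ∃ k, up^[k + 1] m = up g ∧ ∀ l < k, ¬ IsMarked μ (up^[l] m) := by
  rw [chain, Finset.mem_filter]
  exact ⟨fun h => h.2, fun h => ⟨(mem_nodeChildren.1 h.1.mem_nodeChildren).1, h⟩⟩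

/-- The marked edge below `n`, if there is one. -/
def markedBelow (μ : Marking S a b rank) (n : Node V) : Finset (Node V) :=
  (nodes S a b).filter fun g => IsMarked μ g ∧ up g = n

theorem mem_markedBelow {n g : Node V} : g ∈ markedBelow μ n ↔ IsMarked μ g ∧ up g = n := by
  rw [markedBelow, Finset.mem_filter]
  exact ⟨fun h => h.2, fun h => ⟨(mem_nodeChildren.1 h.1.mem_nodeChildren).1, h⟩⟩

theorem card_markedBelow_le (n : Node V) : #(markedBelow μ n) ≤ 1 := by
  refine Finset.card_le_one.2 fun g hg g' hg' => ?_
  rw [mem_markedBelow] at hg hg'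
  exact hg.1.eq hg'.1 (hg.2.trans hg'.2.symm)

theorem chain_subset_markedBelow {m : Node V} (h : IsMarked μ m ∨ up m = none) :
    chain μ m ⊆ markedBelow μ (up m) := by
  intro g hg
  obtain ⟨hg1, k, hk, hl⟩ := mem_chain.1 hg
  refine mem_markedBelow.2 ⟨hg1, ?_⟩
  cases k with
  | zero => exact hk.symm
  | succ k =>
    rcases h with h | h
    · exact absurd h (hl 0 (by omega))
    · rw [← hk, Function.iterate_succ_apply, h, iterate_nodeParent_none]

theorem chain_subset_union (m : Node V) :
    chain μ m ⊆ markedBelow μ (up m) ∪ chain μ (up m) := by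
  intro g hg
  obtain ⟨hg1, k, hk, hl⟩ := mem_chain.1 hg
  cases k with
  | zero => exact Finset.mem_union_left _ (mem_markedBelow.2 ⟨hg1, hk.symm⟩)
  | succ k =>
    refine Finset.mem_union_right _ (mem_chain.2 ⟨hg1, k, hk, fun l hlk => ?_⟩)
    exact hl (l + 1) (by omega)

theorem chain_subset_of_root {m m' : Node V} (h : up m = none) (h' : up m' = none) :
    chain μ m ⊆ chain μ m' := by
  intro g hg
  have := mem_markedBelow.1 (chain_subset_markedBelow (Or.inr h) hg)
  exact mem_chain.2 ⟨this.1, 0, by rw [this.2, h]; exact h', by simp⟩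

theorem chain_congr {m : Node V} {μ' : Marking S a b rank}
    (h : ∀ k g, up g = up^[k + 1] m → (IsMarked μ' g ↔ IsMarked μ g)) :
    chain μ' m = chain μ m := by
  ext g
  rw [mem_chain, mem_chain]
  have h1 : ∀ l, IsMarked μ' (up^[l] m) ↔ IsMarked μ (up^[l] m) := fun l =>
    h l _ (Function.iterate_succ_apply' _ _ _).symm
  simp only [h1]
  constructor
  · rintro ⟨hg, k, hk, hl⟩; exact ⟨(h k g hk.symm).1 hg, k, hk, hl⟩
  · rintro ⟨hg, k, hk, hl⟩; exact ⟨(h k g hk.symm).2 hg, k, hk, hl⟩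

/-- For a uniformly random marking the size of `chain μ m` is stochastically dominated by a
geometric random variable: at every node with two children the walk up from `m` stops with
probability `1 / 2`. -/
theorem IsBinary.sum_harmonic_chain_le (hB : IsBinary S a b rank R) {m : Node V}
    (hm : m ∈ nodes S a b) (hm0 : m ≠ none) (i : ℕ) :
    ∑ μ : Marking S a b rank, (harmonic (i + #(chain μ m)) : ℝ) ≤
      Fintype.card (Marking S a b rank) * geomHarmonic i := by
  induction h : level S a b m using Nat.strong_induction_on generalizing m i with
  | _ d ih =>
    subst h
    by_cases hroot : up m = none
    · calc ∑ μ : Marking S a b rank, (harmonic (i + #(chain μ m)) : ℝ)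
          ≤ ∑ _μ : Marking S a b rank, geomHarmonic i := by
            refine Finset.sum_le_sum fun μ _ => le_trans ?_ (harmonic_le_geomHarmonic i)
            refine harmonic_cast_mono ?_
            have h1 := Finset.card_le_card (chain_subset_markedBelow (μ := μ) (Or.inr hroot))
            have h2 := card_markedBelow_le (μ := μ) (up m)
            omega
        _ = _ := by simp
    have ih' := fun j => ih _ (hB.level_lt m hm0) (hB.parent_mem m hm) hroot j rfl
    by_cases h2 : #(nodeChildren S a b rank (up m)) = 2
    · obtain ⟨F, hF, hFm, hFg⟩ := exists_flip (hB.parent_mem m hm) h2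
        (mem_nodeChildren.2 ⟨hm, hm0, rfl⟩)
      have hchain : ∀ μ, chain (F μ) (up m) = chain μ (up m) := by
        refine fun μ => chain_congr fun k g hg => hFg μ g fun h => ?_
        have := hB.level_iterate_succ_lt hroot k
        rw [← hg, h] at this
        omega
      have hmarked : ∀ μ : Marking S a b rank, IsMarked μ m →
          (harmonic (i + #(chain μ m)) : ℝ) ≤ harmonic (i + 1) := by
        intro μ hμ
        refine harmonic_cast_mono ?_
        have h1 := Finset.card_le_card (chain_subset_markedBelow (Or.inl hμ))
        have h2 := card_markedBelow_le (μ := μ) (up m)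
        omega
      have hunmarked : ∀ μ : Marking S a b rank,
          (harmonic (i + #(chain μ m)) : ℝ) ≤ harmonic (i + 1 + #(chain μ (up m))) := by
        intro μ
        refine harmonic_cast_mono ?_
        have h1 := (Finset.card_le_card (chain_subset_union (μ := μ) m)).trans
          (Finset.card_union_le _ _)
        have h2 := card_markedBelow_le (μ := μ) (up m)
        omega
      have h3 : 2 * ∑ μ : Marking S a b rank, (harmonic (i + #(chain μ m)) : ℝ) ≤
          ∑ μ : Marking S a b rank,
            ((harmonic (i + 1) : ℝ) + harmonic (i + 1 + #(chain μ (up m)))) := by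
        rw [two_mul_sum_eq hF]
        refine Finset.sum_le_sum fun μ _ => ?_
        by_cases hμ : IsMarked μ m
        · have := hunmarked (F μ)
          rw [hchain] at this
          exact add_le_add (hmarked μ hμ) this
        · rw [add_comm]
          exact add_le_add (hmarked (F μ) ((hFm μ).2 hμ)) (hunmarked μ)
      rw [Finset.sum_add_distrib, Finset.sum_const, nsmul_eq_mul, Finset.card_univ] at h3
      have h4 := ih' (i + 1)
      have h5 := geomHarmonic_eq i
      rw [h5]
      linarith
    · refine (Finset.sum_le_sum fun μ _ => harmonic_cast_mono ?_).trans (ih' i)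
      have h1 := Finset.card_le_card (chain_subset_union (μ := μ) m)
      have h3 : markedBelow μ (up m) = ∅ := by
        rw [Finset.eq_empty_iff_forall_notMem]
        intro g hg
        obtain ⟨hg, hgp⟩ := mem_markedBelow.1 hg
        obtain ⟨h, -⟩ := isMarked_iff.1 hg
        exact h2 (hgp ▸ h.2)
      rw [h3, Finset.empty_union] at h1
      omega

end Chain

/-! ### The witnesses of the first edges at a vertex -/

section FirstEdges

variable {V : Type*} [Fintype V] {S : SimpleGraph V} {a b : V} {rank : V → V → ℕ}
  {R : Finset V} {μ : Marking S a b rank}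

local notation "up" => nodeParent S a b rank

theorem iterate_nodeParent_dummy (v : V) (j l : ℕ) : up^[j] (some (v, l + j)) = some (v, l) := by
  induction j with
  | zero => rfl
  | succ j ih => rw [Function.iterate_succ_apply]; exact ih

/-- The marked edges below the nodes `(v, 0), …, (v, s - 1)`. -/
def markedBelowFirst (μ : Marking S a b rank) (v : V) (s : ℕ) : Finset (Node V) :=
  (Finset.range s).biUnion fun l => markedBelow μ (some (v, l))

theorem mem_markedBelowFirst {v : V} {s : ℕ} {g : Node V} :
    g ∈ markedBelowFirst μ v s ↔ IsMarked μ g ∧ ∃ l < s, up g = some (v, l) := by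
  simp only [markedBelowFirst, Finset.mem_biUnion, Finset.mem_range, mem_markedBelow]
  tauto

theorem card_markedBelowFirst_le (v : V) (s : ℕ) : #(markedBelowFirst μ v s) ≤ s := by
  refine Finset.card_biUnion_le.trans ?_
  refine (Finset.sum_le_sum fun l _ => card_markedBelow_le (μ := μ) (some (v, l))).trans ?_
  simp

/-- A vertex with `k` children is split into at most `k - 1` nodes with two children. -/
theorem succ_lt_of_isMarked (hS : S.IsTree) (hab : S.Adj a b) {g : Node V} {v : V} {l : ℕ}
    (hg : IsMarked μ g) (h : up g = some (v, l)) : l + 1 < #(children S a b v) := by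
  obtain ⟨⟨h1, h2⟩, -⟩ := isMarked_iff.1 hg
  rw [h] at h1 h2
  rw [mem_nodes] at h1
  by_contra hlt
  obtain ⟨m, hm, m', hm', hne⟩ := Finset.one_lt_card.1
    (by omega : 1 < #(nodeChildren S a b rank (some (v, l))))
  rcases eq_of_mem_nodeChildren hS hab hm with ⟨-, h⟩ | ⟨w, hw, rfl, -⟩
  · omega
  rcases eq_of_mem_nodeChildren hS hab hm' with ⟨-, h⟩ | ⟨w', hw', rfl, -⟩
  · omega
  refine hne ?_
  rw [Finset.card_le_one.1 (by omega : #(children S a b v) ≤ 1) w hw w' hw']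

/-- The walk up from a child of `v` passes through dummy nodes of `v` until it reaches `v`. -/
theorem chain_child_subset (hS : S.IsTree) (hab : S.Adj a b) {v w : V}
    (hw : w ∈ children S a b v) : chain μ (some (w, 0)) ⊆
      chain μ (some (v, 0)) ∪ markedBelowFirst μ v (childIndex S a b rank w + 1) := by
  intro g hg
  obtain ⟨hg1, k, hk, hl⟩ := mem_chain.1 hg
  set t := min (childIndex S a b rank w) (#(children S a b v) - 2) with ht
  have hup : up (some (w, 0)) = some (v, t) := nodeParent_child hS hab hw
  have hiter : ∀ j, up^[t + 1 + j] (some (w, 0)) = up^[j] (some (v, 0)) := by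
    intro j
    rw [add_comm, Function.iterate_add_apply, Function.iterate_succ_apply, hup]
    congr 1
    simpa using iterate_nodeParent_dummy (S := S) (a := a) (b := b) (rank := rank) v t 0
  by_cases hkt : k ≤ t
  · refine Finset.mem_union_right _ (mem_markedBelowFirst.2 ⟨hg1, t - k, by omega, ?_⟩)
    rw [← hk, Function.iterate_succ_apply, hup]
    have := iterate_nodeParent_dummy (S := S) (a := a) (b := b) (rank := rank) v k (t - k)
    rwa [Nat.sub_add_cancel hkt] at this
  · refine Finset.mem_union_left _ (mem_chain.2 ⟨hg1, k - t - 1, ?_, fun l hlk => ?_⟩)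
    · rw [← hk, ← hiter]
      exact congrArg (fun k => up^[k] (some (w, 0))) (by omega)
    · rw [← hiter]
      exact hl _ (by omega)

/-- The witnesses of the first `i` edges at `v`. -/
def firstWitnesses (R : Finset V) (μ : Marking S a b rank) (v : V) (i : ℕ) : Finset (Sym2 V) :=
  univ.filter fun e => ∃ u, S.Adj v u ∧ rank v u < i ∧ e ∈ witnessSet R μ s(v, u)

theorem mem_firstWitnesses {v : V} {i : ℕ} {e : Sym2 V} : e ∈ firstWitnesses R μ v i ↔
    ∃ u, S.Adj v u ∧ rank v u < i ∧ e ∈ witnessSet R μ s(v, u) := by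
  simp [firstWitnesses]

theorem IsBinary.exists_of_mem_firstWitnesses (hB : IsBinary S a b rank R) (hS : S.IsTree)
    (hab : S.Adj a b) {v : V} {i : ℕ} {e : Sym2 V} (he : e ∈ firstWitnesses R μ v i) :
    ∃ g, witnessOf R μ g = e ∧
      ((rank v (upNeighbor S a b v) < i ∧ g ∈ chain μ (some (v, 0))) ∨
        ∃ w ∈ children S a b v, rank v w < i ∧ g ∈ chain μ (some (w, 0))) := by
  obtain ⟨u, hvu, hui, he⟩ := mem_firstWitnesses.1 he
  obtain ⟨v', hv', g, hg, rfl⟩ := hB.witnessSet_subset he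
  refine ⟨g, rfl, ?_⟩
  rw [originalEdge_eq] at hv'
  rcases Sym2.eq_iff.1 hv' with ⟨rfl, rfl⟩ | ⟨rfl, h⟩
  · exact Or.inl ⟨hui, hg⟩
  · rcases (adj_iff hS hab v v').1 hvu with h' | h'
    · -- `v` and `v'` are the ends of the split edge, both halves of which have the same witnesses
      refine Or.inl ⟨h' ▸ hui, chain_subset_of_root ?_ ?_ hg⟩
      · exact nodeParent_root (upNeighbor_eq_root hS hab h.symm h')
      · exact nodeParent_root (upNeighbor_eq_root hS hab h' h.symm)
    · exact Or.inr ⟨v', h', hui, hg⟩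

variable [DecidableRel S.Adj] {c : Sym2 V → ℝ≥0}

theorem childIndex_le_rank (hS : S.IsTree) (hab : S.Adj a b) (hrank : IsCostOrder S c rank)
    {v w : V} (hw : w ∈ children S a b v) : childIndex S a b rank w ≤ rank v w := by
  rw [childIndex_eq hS hab hw]
  refine le_of_le_of_eq (Finset.card_le_card_of_injOn (t := Finset.range (rank v w)) (rank v)
    (fun u hu => ?_) ((injOn_rank (a := a) (b := b) hrank v).mono fun u hu => ?_))
    (Finset.card_range _)
  · simpa using (Finset.mem_filter.1 hu).2
  · exact (Finset.mem_filter.1 hu).1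

/-- Among the first `i` edges at `v`, the edge towards the root takes one of the positions. -/
theorem childIndex_add_two_le (hS : S.IsTree) (hab : S.Adj a b) (hrank : IsCostOrder S c rank)
    {v w : V} {i : ℕ} (hw : w ∈ children S a b v) (hwi : rank v w < i)
    (hup : rank v (upNeighbor S a b v) < i) : childIndex S a b rank w + 2 ≤ i := by
  have hadj := adj_iff hS hab v
  have hne : ∀ u ∈ children S a b v, rank v u ≠ rank v (upNeighbor S a b v) := by
    intro u hu h
    have := (hrank v).1.injOn ((hadj u).2 (Or.inr hu)) ((hadj _).2 (Or.inl rfl)) h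
    exact upNeighbor_notMem hS hab v (this ▸ hu)
  have h1 : childIndex S a b rank w ≤
      #(((Finset.range i).erase (rank v w)).erase (rank v (upNeighbor S a b v))) := by
    rw [childIndex_eq hS hab hw]
    refine Finset.card_le_card_of_injOn (rank v) (fun u hu => ?_)
      ((injOn_rank (a := a) (b := b) hrank v).mono fun u hu => (Finset.mem_filter.1 hu).1)
    obtain ⟨hu, hlt⟩ := Finset.mem_filter.1 hu
    simp only [Finset.coe_erase, Finset.coe_range, Set.mem_sdiff, Set.mem_Iio,
      Set.mem_singleton_iff]
    exact ⟨⟨by omega, by omega⟩, hne u hu⟩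
  rw [Finset.card_erase_of_mem, Finset.card_erase_of_mem, Finset.card_range] at h1
  · have := hne w hw
    omega
  · exact Finset.mem_range.2 hwi
  · exact Finset.mem_erase.2 ⟨(hne w hw).symm, Finset.mem_range.2 hup⟩

theorem IsBinary.card_firstWitnesses_le (hB : IsBinary S a b rank R) (hS : S.IsTree)
    (hab : S.Adj a b) (hrank : IsCostOrder S c rank) (v : V) (i : ℕ) :
    #(firstWitnesses R μ v i) ≤ i + #(chain μ (some (v, 0))) := by
  have hsub : firstWitnesses R μ v i ⊆
      (chain μ (some (v, 0)) ∪ markedBelowFirst μ v i).image (witnessOf R μ) := by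
    intro e he
    obtain ⟨g, rfl, ⟨-, hg⟩ | ⟨w, hw, hwi, hg⟩⟩ := hB.exists_of_mem_firstWitnesses hS hab he
    · exact Finset.mem_image_of_mem _ (Finset.mem_union_left _ hg)
    · refine Finset.mem_image_of_mem _ ?_
      rcases Finset.mem_union.1 (chain_child_subset hS hab hw hg) with h | h
      · exact Finset.mem_union_left _ h
      · obtain ⟨h1, l, hl, h2⟩ := mem_markedBelowFirst.1 h
        have := childIndex_le_rank hS hab hrank hw
        exact Finset.mem_union_right _ (mem_markedBelowFirst.2 ⟨h1, l, by omega, h2⟩)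
  have h1 := (Finset.card_le_card hsub).trans Finset.card_image_le
  have h2 := Finset.card_union_le (chain μ (some (v, 0))) (markedBelowFirst μ v i)
  have h3 := card_markedBelowFirst_le (μ := μ) v i
  omega

/-- If the edge at `v` towards the root is among the first `i` edges, or all the other edges are,
then at most `i - 1` of the nodes into which `v` is split contribute a witness. -/
theorem IsBinary.card_firstWitnesses_le_pred (hB : IsBinary S a b rank R) (hS : S.IsTree)
    (hab : S.Adj a b) (hrank : IsCostOrder S c rank) {v : V} {i : ℕ}
    (h : rank v (upNeighbor S a b v) < i ∨ #(children S a b v) ≤ i) :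
    #(firstWitnesses R μ v i) ≤ i - 1 + #(chain μ (some (v, 0))) := by
  have hsub : firstWitnesses R μ v i ⊆
      (chain μ (some (v, 0)) ∪ markedBelowFirst μ v (i - 1)).image (witnessOf R μ) := by
    intro e he
    obtain ⟨g, rfl, ⟨-, hg⟩ | ⟨w, hw, hwi, hg⟩⟩ := hB.exists_of_mem_firstWitnesses hS hab he
    · exact Finset.mem_image_of_mem _ (Finset.mem_union_left _ hg)
    · refine Finset.mem_image_of_mem _ ?_
      rcases Finset.mem_union.1 (chain_child_subset hS hab hw hg) with h' | h'
      · exact Finset.mem_union_left _ h'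
      · obtain ⟨h1, l, hl, h2⟩ := mem_markedBelowFirst.1 h'
        refine Finset.mem_union_right _ (mem_markedBelowFirst.2 ⟨h1, l, ?_, h2⟩)
        rcases h with h | h
        · have := childIndex_add_two_le hS hab hrank hw hwi h
          omega
        · have := succ_lt_of_isMarked hS hab h1 h2
          omega
  have h1 := (Finset.card_le_card hsub).trans Finset.card_image_le
  have h2 := Finset.card_union_le (chain μ (some (v, 0))) (markedBelowFirst μ v (i - 1))
  have h3 := card_markedBelowFirst_le (μ := μ) v (i - 1)
  omega

/-- The edges to the first `j` children of `v` are all marked. -/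
def AllMarked (μ : Marking S a b rank) (v : V) (j : ℕ) : Prop :=
  ∀ w ∈ children S a b v, childIndex S a b rank w < j → IsMarked μ (some (w, 0))

/-- A marked edge is its own only witness. -/
theorem IsBinary.card_firstWitnesses_le_of_allMarked (hB : IsBinary S a b rank R)
    (hS : S.IsTree) (hab : S.Adj a b) (hrank : IsCostOrder S c rank) {v : V} {i : ℕ}
    (h : ¬ rank v (upNeighbor S a b v) < i) (hm : AllMarked μ v i) :
    #(firstWitnesses R μ v i) ≤ i := by
  have hsub : firstWitnesses R μ v i ⊆ (markedBelowFirst μ v i).image (witnessOf R μ) := by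
    intro e he
    obtain ⟨g, rfl, ⟨h', -⟩ | ⟨w, hw, hwi, hg⟩⟩ := hB.exists_of_mem_firstWitnesses hS hab he
    · exact absurd h' h
    · refine Finset.mem_image_of_mem _ ?_
      have hidx := childIndex_le_rank hS hab hrank hw
      have := mem_markedBelow.1
        (chain_subset_markedBelow (Or.inl (hm w hw (by omega))) hg)
      rw [nodeParent_child hS hab hw] at this
      exact mem_markedBelowFirst.2 ⟨this.1, _, by omega, this.2⟩
  exact ((Finset.card_le_card hsub).trans Finset.card_image_le).trans
    (card_markedBelowFirst_le v i)

/-- The choices made below `v` are independent of the chain above `v`. -/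
theorem IsBinary.sum_allMarked (hB : IsBinary S a b rank R) (hS : S.IsTree)
    (hab : S.Adj a b) (hrank : IsCostOrder S c rank) {v : V} (ψ : ℕ → ℝ) {j : ℕ}
    (hj : j < #(children S a b v)) :
    ∑ μ : Marking S a b rank, (if AllMarked μ v j then ψ #(chain μ (some (v, 0))) else 0) =
      1 / 2 ^ j * ∑ μ : Marking S a b rank, ψ #(chain μ (some (v, 0))) := by
  induction j with
  | zero => simp [AllMarked]
  | succ j ih =>
    obtain ⟨w, hw, hwj⟩ := exists_childIndex_eq hS hab hrank (v := v) (j := j) (by omega)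
    obtain ⟨F, hF, hFm, hFg⟩ := exists_flip (mem_nodes.2 (lt_max_of_lt_right (by omega)))
      (card_nodeChildren_eq_two hS hab hrank hj)
      (mem_nodeChildren_of_childIndex hS hab hw (by omega))
    have hchain : ∀ μ, chain (F μ) (some (v, 0)) = chain μ (some (v, 0)) := by
      refine fun μ => chain_congr fun k g hg => hFg μ g fun h => ?_
      have := hB.level_iterate_succ_lt (n := some (v, 0)) (by simp) k
      rw [← hg, h] at this
      simp only [level] at this
      omega
    have hall : ∀ μ, AllMarked (F μ) v j ↔ AllMarked μ v j := by
      refine fun μ => forall₂_congr fun w' hw' => imp_congr_right fun hlt => hFg μ _ ?_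
      rw [nodeParent_child hS hab hw']
      intro h
      simp only [Option.some.injEq, Prod.mk.injEq, true_and] at h
      omega
    have hsucc : ∀ μ : Marking S a b rank, AllMarked μ v (j + 1) ↔
        AllMarked μ v j ∧ IsMarked μ (some (w, 0)) := by
      intro μ
      constructor
      · exact fun h => ⟨fun w' hw' hlt => h w' hw' (by omega), h w hw (by omega)⟩
      · rintro ⟨h1, h2⟩ w' hw' hlt
        rcases Nat.lt_succ_iff_lt_or_eq.1 hlt with h | h
        · exact h1 w' hw' h
        · rwa [childIndex_inj hS hab hrank hw' hw (h.trans hwj.symm)]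
    have h2 : 2 * ∑ μ : Marking S a b rank,
        (if AllMarked μ v (j + 1) then ψ #(chain μ (some (v, 0))) else 0) =
        ∑ μ : Marking S a b rank, (if AllMarked μ v j then ψ #(chain μ (some (v, 0))) else 0) := by
      rw [two_mul_sum_eq hF]
      refine Finset.sum_congr rfl fun μ _ => ?_
      simp only [hsucc, hall, hchain, hFm]
      by_cases h1 : AllMarked μ v j <;> by_cases h2 : IsMarked μ (some (w, 0)) <;> simp [h1, h2]
    rw [ih (by omega)] at h2
    rw [pow_succ, one_div, mul_inv]
    rw [one_div] at h2
    linarith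

theorem IsBinary.sum_harmonic_firstWitnesses_le (hB : IsBinary S a b rank R) (hS : S.IsTree)
    (hab : S.Adj a b) (hrank : IsCostOrder S c rank) (v : V) {i : ℕ} (hi : 1 ≤ i) :
    ∑ μ : Marking S a b rank, (harmonic #(firstWitnesses R μ v i) : ℝ) ≤
      Fintype.card (Marking S a b rank) *
        (1 / 2 ^ i * harmonic i + (1 - 1 / 2 ^ i) * geomHarmonic i) := by
  have hsum := fun j => hB.sum_harmonic_chain_le (zero_mem_nodes v) (by simp) j
  by_cases h : rank v (upNeighbor S a b v) < i ∨ #(children S a b v) ≤ i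
  · calc ∑ μ : Marking S a b rank, (harmonic #(firstWitnesses R μ v i) : ℝ)
        ≤ ∑ μ : Marking S a b rank, (harmonic (i - 1 + #(chain μ (some (v, 0)))) : ℝ) :=
          Finset.sum_le_sum fun μ _ =>
            harmonic_cast_mono (hB.card_firstWitnesses_le_pred hS hab hrank h)
      _ ≤ _ := (hsum (i - 1)).trans
          (mul_le_mul_of_nonneg_left (geomHarmonic_pred_le hi) (Nat.cast_nonneg _))
  · push Not at h
    have hind := hB.sum_allMarked hS hab hrank
      (fun q => (harmonic (i + q) : ℝ) - harmonic i) h.2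
    rw [Finset.sum_sub_distrib, Finset.sum_const, nsmul_eq_mul, Finset.card_univ] at hind
    have hle : ∑ μ : Marking S a b rank, (harmonic #(firstWitnesses R μ v i) : ℝ) ≤
        ∑ μ : Marking S a b rank, ((harmonic (i + #(chain μ (some (v, 0)))) : ℝ) -
          if AllMarked μ v i then
            (harmonic (i + #(chain μ (some (v, 0)))) : ℝ) - harmonic i else 0) := by
      refine Finset.sum_le_sum fun μ _ => ?_
      split_ifs with hm
      · rw [sub_sub_cancel]
        exact harmonic_cast_mono
          (hB.card_firstWitnesses_le_of_allMarked hS hab hrank h.1.not_gt hm)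
      · rw [sub_zero]
        exact harmonic_cast_mono (hB.card_firstWitnesses_le hS hab hrank v i)
    rw [Finset.sum_sub_distrib, hind] at hle
    have h1 : (0 : ℝ) ≤ 1 - 1 / 2 ^ i := by
      rw [sub_nonneg, div_le_one (by positivity)]
      exact one_le_pow₀ (by norm_num)
    have h2 := mul_le_mul_of_nonneg_left (hsum i) h1
    refine hle.trans ?_
    linarith

theorem IsBinary.expectedTime_le {ρ : V} {M : ℝ} (hB : IsBinary S a b rank R) (hS : S.IsTree)
    (hab : S.Adj a b) (hrank : IsCostOrder S c rank) (hM : 0 < M) {π : Procedure R ρ M}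
    {y : State V → LPSolution R ρ M}
    (hπ : ∀ T : Finset (Sym2 V), State.Good R (T, []) → ∀ W : Finset (Sym2 V),
      ∑' t : ℕ, (run π y T t).toOuterMeasure {st | ∃ e ∈ W, e ∈ st.1} ≤
        ENNReal.ofReal (M * harmonic #W)) (v : V) {i : ℕ} (hi : 1 ≤ i) :
    expectedTime S a b rank π y v i ≤ ENNReal.ofReal (bound M i) := by
  have h1 : ∀ μ : Marking S a b rank, expectedTimeOf π y μ v i ≤
      ENNReal.ofReal (M * harmonic #(firstWitnesses R μ v i)) := by
    refine fun μ => le_trans (ENNReal.tsum_le_tsum fun t => ?_)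
      (hπ _ (hB.good_witnessTree μ) (firstWitnesses R μ v i))
    refine (run π y (witnessTree R μ) t).toOuterMeasure.mono ?_
    rintro st ⟨u, hu, hui, e, he, hst⟩
    exact ⟨e, mem_firstWitnesses.2 ⟨u, hu, hui, he⟩, hst⟩
  rw [expectedTime]
  refine ENNReal.div_le_of_le_mul ((Finset.sum_le_sum fun μ _ => h1 μ).trans ?_)
  rw [← ENNReal.ofReal_sum_of_nonneg fun μ _ => mul_nonneg hM.le (harmonic_cast_nonneg _),
    ← Finset.mul_sum, ← ENNReal.ofReal_natCast, ← ENNReal.ofReal_mul' (Nat.cast_nonneg _), bound_eq]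
  refine ENNReal.ofReal_le_ofReal ?_
  rw [mul_assoc, mul_comm (_ + _)]
  exact mul_le_mul_of_nonneg_left (hB.sum_harmonic_firstWitnesses_le hS hab hrank v hi) hM.le

end FirstEdges

end MinPower

end

theorem lemma4 {V : Type*} [Fintype V]
    (S : SimpleGraph V) [DecidableRel S.Adj] (hS : S.IsTree)
    (R : Finset V) (hR : ∀ v, v ∈ R ↔ S.degree v = 1)
    (c : Sym2 V → NNReal) (rank : V → V → ℕ) (hrank : MinPower.IsCostOrder S c rank)
    (a b : V) (hab : S.Adj a b)
    (ρ : V) (hρ : ρ ∈ R) (M : ℝ) (hM : 0 < M) :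
    (∃ π : MinPower.Procedure R ρ M, π.Valid ∧
      ∀ (y : MinPower.State V → MinPower.LPSolution R ρ M) (v : V) (i : ℕ),
        1 ≤ i → i ≤ S.degree v →
        MinPower.expectedTime S a b rank π y v i ≤ ENNReal.ofReal (MinPower.bound M i)) ∧
    MinPower.bound M 2 / M = 3 * Real.log 4 - 9 / 4 := by
  refine ⟨?_, MinPower.bound_two hM⟩
  obtain ⟨π, hvalid, hπ⟩ := MinPower.exists_procedure hρ hM
  exact ⟨π, hvalid, fun y v i hi _ =>
    (MinPower.isBinary hS hab hrank hR).expectedTime_le hS hab hrank hM (hπ y) v hi⟩
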